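/- **Setting.** Let $D=(0,1)^2$, $N,L\ge 1$. For $k=1,\dots,L$ let $\mathcal T_k$ be the uniform triangulation of $D$ into $n_k\times n_k$ cells, $n_k=N2^{k-1}$, each cut along its diagonal from lower left to upper right; let $\mathcal I_U^k$ be the set of all its nodes (boundary nodes included), $\varphi_i^k$ the P1 hat function of node $i$, and $U^k=\mathrm{span}\{\varphi^k_i: i\in\mathcal I_U^k\}$. For each $k$ fix a set $\mathcal I_V^k\subset\mathcal I_U^k$ of interior nodes, and let $\bar{\mathcal I}_V^k$ be its closure: $\mathcal I_V^k$ together with all $j\in\mathcal I_U^k$ such that $\{\varphi_j^k\ne0\}$ meets $\{\varphi_i^k\neq 0\}$ for some $i\in\mathcal I_V^k$. For $\kappa\in U^L$ let $a_\kappa(u,w)=\int_D\kappa\,\langle\nabla u,\nabla w\rangle\,dx$, let $A_\kappa=(a_\kappa(\varphi^k_i,\varphi^l_j))_{(k,i),(l,j)}$ with $1\le k,l\le L$, $i\in\mathcal I_V^k$, $j\in\mathcal I_V^l$, and $\|\mathbf v\|_{A_\kappa}=(\mathbf v^\top A_\kappa\mathbf v)^{1/2}$. For $f\in U^L$ let $\mathbf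 f^k=(\int_D f\varphi_i^k\,dx)_{i\in\mathcal I_V^k}$ and $\mathbf f=(\mathbf f^k)_k$. The images $\boldsymbol\kappa_{\rm img},\mathbf f_{\rm img}\in\mathbb R^{\mathcal I_U^L}$ are the nodal coefficients of $\kappa$ and $f$ in $U^L$. **LLMG.** Let $\bar A_k=(a_\kappa(\varphi_i^k,\varphi_j^k))_{i\in\mathcal I_V^k,\,j\in\bar{\mathcal I}_V^k}$, let $P_k:\mathbb R^{\bar{\mathcal I}_V^k}\to\mathbb R^{\bar{\mathcal I}_V^{k+1}}$ be nodal interpolation, and let $E_k$ be extension by zero from $\mathcal I_V^k$ to $\bar{\mathcal I}_V^k$. Given $\mathbf u=(\mathbf u^k)_k$, $\mathbf u^k\in\mathbb R^{\mathcal I_V^k}$, one sweep with damping factors $\omega^k$ sets $\tilde{\mathbf u}^1=0$, $\tilde{\mathbf u}^{k+1}=P_k(\tilde{\mathbf u}^k+E_k\mathbf u^k)$, $\bar{\mathbf u}^L=0$, $\bar{\mathbf u}^k=P_k^\top(\bar{\mathbf u}^{k+1}+\bar A_{k+1}^\top\mathbf u^{k+1})$; then for $k=L,\dots,1$ it smooths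 on level $k$, i.e. $\mathbf u^k\gets\mathbf u^k+\omega^k(\mathbf f^k-[\bar A_k(E_k\mathbf u^k+\tilde{\mathbf u}^k)+\bar{\mathbf u}^k|_{\mathcal I_V^k}])$, and, if $k>1$, updates $\bar{\mathbf u}^{k-1}\gets P_{k-1}^\top(\bar{\mathbf u}^k+\bar A_k^\top\mathbf u^k)$; then for $k=1,\dots,L$ it smooths on level $k$ and, if $k<L$, updates $\tilde{\mathbf u}^{k+1}\gets P_k(\tilde{\mathbf u}^k+E_k\mathbf u^k)$. $\mathrm{LLMG}^m(0,\mathbf f,\kappa)$ denotes the result of $m$ sweeps started from $0$. **CNNs.** The activation function $\sigma:\mathbb R\to\mathbb R$ is in $L^\infty_{\rm loc}$ and, for some $x_0$, is three times continuously differentiable near $x_0$ with $\sigma''(x_0)\ne0$. A CNN is a finite sequence of convolutional units on images of the sizes $\mathcal I_U^1,\dots,\mathcal I_U^L$. Each unit reads finitely many of the images present (the inputs and earlier outputs; skip connections are allowed) on one level, convolves each with a square kernel of odd width (vanilla, 2-strided from level $k+1$ to $k$, 2-transpose strided from level $k-1$ to $k$, or submanifold sparse, i.e. acting only at pixels at which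 some input image is nonzero), sums, adds a bias, applies $\sigma$ or the identity, and possibly multiplies with the fixed $0/1$-mask of $\mathcal I_V^k$ or of $\bar{\mathcal I}_V^k$. The two inputs are images in $\mathbb R^{\mathcal I_U^L}$; the output is, for each $k$, one image of level $k$ restricted to $\mathcal I_V^k$. The number of weights $M(\Psi)$ counts all kernel entries and all biases of all units. **Theorem.** There is a universal constant $C>0$ such that the following holds for all $\sigma$, $N$, $L$, $(\mathcal I_V^k)_k$ as above and all $m\in\mathbb N$. Let $\mathfrak c,\mathfrak C>0$, let $0<\omega^k\le\mathfrak C^{-1}$ for $k=1,\dots,L$, and let $(\kappa_y)_{y\in\Gamma}$ be a family in $U^L$ such that all eigenvalues of $A_y:=A_{\kappa_y}$ lie in $[\mathfrak c,\mathfrak C]$ for every $y\in\Gamma$. Then for all $\varepsilon,M>0$ there exists a CNN $\Psi:\mathbb R^{2\times\mathcal I_U^L}\to\mathbb R^{\times_{k=1}^L\mathcal I_V^k}$ such that 1. $\|\Psi(\boldsymbol\kappa_{y,\rm img},\mathbf f_{\rm img})-\mathrm{LLMG}^m(0,\mathbf f,\kappa_y)\|_{A_y}\le\varepsilon$ for all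 $y\in\Gamma$ and $f\in U^L$ with $\|\boldsymbol\kappa_{y,\rm img}\|_\infty\le M$ and $\|\mathbf f_{\rm img}\|_\infty\le M$; 2. $M(\Psi)\le C\,L\,m$. -/

import Mathlib

noncomputable section

namespace LocalMultigrid

open MeasureTheory Matrix

/-! ### Uniform grids and hat functions

Levels are numbered `0, 1, …, L - 1`, level `0` being the coarsest.  Level `k` is the grid on the
unit square with `N * 2 ^ k` cells in each direction; its nodes, those on the boundary included,
are the pixels of the images of level `k`. -/

/-- The index set of all nodes of level `k`. -/
abbrev Node (N k : ℕ) : Type := Fin (N * 2 ^ k + 1) × Fin (N * 2 ^ k + 1)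

/-- An image of level `k`: one number per node. -/
abbrev Image (N k : ℕ) : Type := Node N k → ℝ

/-- The position of a node in the unit square. -/
def nodePos (N k : ℕ) (i : Node N k) : ℝ × ℝ :=
  ((i.1.val : ℝ) / ((N : ℝ) * 2 ^ k), (i.2.val : ℝ) / ((N : ℝ) * 2 ^ k))

/-- The node does not lie on the boundary of the unit square. -/
def IsInterior {N k : ℕ} (i : Node N k) : Prop :=
  0 < i.1.val ∧ i.1.val < N * 2 ^ k ∧ 0 < i.2.val ∧ i.2.val < N * 2 ^ k

/-- The nodal hat function of node `i` for the triangulation that cuts every cell along the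
diagonal from its lower left to its upper right corner.  It is affine on every triangle, equal to
`1` at node `i` and to `0` at all other nodes; its support is the hexagon formed by the six
triangles that meet at node `i`. -/
def hat (N k : ℕ) (i : Node N k) (x : ℝ × ℝ) : ℝ :=
  let s : ℝ := (N : ℝ) * 2 ^ k * x.1 - (i.1.val : ℝ)
  let t : ℝ := (N : ℝ) * 2 ^ k * x.2 - (i.2.val : ℝ)
  max 0 (1 - max (max |s| |t|) |s - t|)

/-- The finite element function of level `k` with coefficient image `c`. -/
def feFun (N k : ℕ) (c : Image N k) (x : ℝ × ℝ) : ℝ := ∑ i, c i * hat N k i x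

/-! ### The variational problem -/

/-- The open unit square. -/
def unitSquare : Set (ℝ × ℝ) := Set.Ioo 0 1 ×ˢ Set.Ioo 0 1

/-- The inner product of the gradients of `u` and `w` (for hat functions the partial derivatives
exist almost everywhere). -/
def gradDot (u w : ℝ × ℝ → ℝ) (x : ℝ × ℝ) : ℝ :=
  deriv (fun s => u (s, x.2)) x.1 * deriv (fun s => w (s, x.2)) x.1 +
    deriv (fun t => u (x.1, t)) x.2 * deriv (fun t => w (x.1, t)) x.2

/-- The bilinear form `∫_D κ ⟨∇u, ∇w⟩`. -/
def darcyForm (κ u w : ℝ × ℝ → ℝ) : ℝ := ∫ x in unitSquare, κ x * gradDot u w x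

/-- The set of selected nodes, level by level (only levels `< L` are ever used). -/
abbrev Selection (N : ℕ) : Type := (k : ℕ) → Finset (Node N k)

/-- The indices `(k, i)` of the coefficients of the locally refined discretization. -/
abbrev Dof {N : ℕ} (V : Selection N) (L : ℕ) : Type := (k : Fin L) × {i // i ∈ V k}

/-- The matrix of the discretized operator with respect to all selected hat functions of all
levels. -/
def stiffness {N : ℕ} (V : Selection N) (L : ℕ) (κ : ℝ × ℝ → ℝ) : Matrix (Dof V L) (Dof V L) ℝ :=
  fun p q => darcyForm κ (hat N p.1 p.2.1) (hat N q.1 q.2.1)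

/-- The norm `√(vᵀ A v)`. -/
def energyNorm {ι : Type*} [Fintype ι] (A : Matrix ι ι ℝ) (v : ι → ℝ) : ℝ :=
  Real.sqrt (v ⬝ᵥ (A *ᵥ v))

/-- The part of the load vector of `f` that belongs to level `k`. -/
def load {N : ℕ} (V : Selection N) (f : ℝ × ℝ → ℝ) (k : ℕ) (i : {i // i ∈ V k}) : ℝ :=
  ∫ x in unitSquare, f x * hat N k i.1 x

/-! ### The levelwise local multigrid algorithm -/

open Classical in
/-- The closure of the selected nodes of level `k`: the selected nodes, and all nodes whose hat
function overlaps one of a selected node. -/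
def closureNodes {N : ℕ} (V : Selection N) (k : ℕ) : Finset (Node N k) :=
  V k ∪ Finset.univ.filter fun j =>
    (Function.support (hat N k j) ∩ ⋃ i ∈ V k, Function.support (hat N k i)).Nonempty

/-- Coefficient vectors on the selected nodes of level `k`. -/
abbrev VVec {N : ℕ} (V : Selection N) (k : ℕ) : Type := {i // i ∈ V k} → ℝ

/-- Coefficient vectors on the closure of the selected nodes of level `k`. -/
abbrev CVec {N : ℕ} (V : Selection N) (k : ℕ) : Type := {i // i ∈ closureNodes V k} → ℝ

/-- The matrix of the operator on level `k`, with rows for the selected nodes and columns for their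
closure. -/
def levelMatrix {N : ℕ} (V : Selection N) (κ : ℝ × ℝ → ℝ) (k : ℕ) :
    Matrix {i // i ∈ V k} {j // j ∈ closureNodes V k} ℝ :=
  fun i j => darcyForm κ (hat N k i.1) (hat N k j.1)

/-- The prolongation from level `k` to level `k + 1`: nodal interpolation.  Its transpose is the
weighted restriction. -/
def prolongation {N : ℕ} (V : Selection N) (k : ℕ) :
    Matrix {j // j ∈ closureNodes V (k + 1)} {i // i ∈ closureNodes V k} ℝ :=
  fun j i => hat N k i.1 (nodePos N (k + 1) j.1)

/-- Extension by zero from the selected nodes to their closure. -/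
def extend {N : ℕ} (V : Selection N) (k : ℕ) (u : VVec V k) : CVec V k :=
  fun j => if h : j.1 ∈ V k then u ⟨j.1, h⟩ else 0

/-- Restriction from the closure to the selected nodes. -/
def restrict {N : ℕ} (V : Selection N) (k : ℕ) (u : CVec V k) : VVec V k :=
  fun i => u ⟨i.1, Finset.mem_union_left _ i.2⟩

/-- The variables of the algorithm: the iterate `u`, and the auxiliary vectors `ubar` (collecting
the finer levels) and `util` (collecting the coarser levels). -/
structure State {N : ℕ} (V : Selection N) where
  u : (k : ℕ) → VVec V k
  ubar : (k : ℕ) → CVec V k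
  util : (k : ℕ) → CVec V k

/-- `ũ⁰ = 0`, `ũᵏ⁺¹ = P_k (ũᵏ + uᵏ)`. -/
def auxTilde {N : ℕ} (V : Selection N) (u : (k : ℕ) → VVec V k) : (k : ℕ) → CVec V k
  | 0 => 0
  | k + 1 => prolongation V k *ᵥ (auxTilde V u k + extend V k (u k))

/-- `d` steps of the recursion `ūᵏ = P_kᵀ (ūᵏ⁺¹ + A_{k+1}ᵀ uᵏ⁺¹)`, started from zero on level
`k + d`. -/
def auxBar {N : ℕ} (V : Selection N) (κ : ℝ × ℝ → ℝ) (u : (k : ℕ) → VVec V k) :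
    (d k : ℕ) → CVec V k
  | 0, _ => 0
  | d + 1, k =>
    (prolongation V k)ᵀ *ᵥ (auxBar V κ u d (k + 1) + (levelMatrix V κ (k + 1))ᵀ *ᵥ u (k + 1))

/-- The damped residual correction on level `k`. -/
def smooth {N : ℕ} (V : Selection N) (κ : ℝ × ℝ → ℝ) (ω : ℕ → ℝ) (f : (k : ℕ) → VVec V k)
    (s : State V) (k : ℕ) : State V :=
  { s with
    u := Function.update s.u k
      (s.u k + ω k • (f k - (levelMatrix V κ k *ᵥ (extend V k (s.u k) + s.util k)
        + restrict V k (s.ubar k)))) }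

/-- One pass through the body of the loop from fine to coarse. -/
def downStep {N : ℕ} (V : Selection N) (κ : ℝ × ℝ → ℝ) (ω : ℕ → ℝ) (f : (k : ℕ) → VVec V k)
    (s : State V) (k : ℕ) : State V :=
  let s' := smooth V κ ω f s k
  match k with
  | 0 => s'
  | j + 1 =>
    { s' with
      ubar := Function.update s'.ubar j
        ((prolongation V j)ᵀ *ᵥ (s'.ubar (j + 1) + (levelMatrix V κ (j + 1))ᵀ *ᵥ s'.u (j + 1))) }

/-- One pass through the body of the loop from coarse to fine. -/
def upStep {N : ℕ} (V : Selection N) (L : ℕ) (κ : ℝ × ℝ → ℝ) (ω : ℕ → ℝ)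
    (f : (k : ℕ) → VVec V k) (s : State V) (k : ℕ) : State V :=
  let s' := smooth V κ ω f s k
  if k + 1 < L then
    { s' with
      util := Function.update s'.util (k + 1)
        (prolongation V k *ᵥ (s'.util k + extend V k (s'.u k))) }
  else s'

/-- One sweep of the levelwise local multigrid algorithm on the levels `0, …, L - 1`. -/
def llmg {N : ℕ} (V : Selection N) (L : ℕ) (κ : ℝ × ℝ → ℝ) (ω : ℕ → ℝ)
    (f : (k : ℕ) → VVec V k) (u : (k : ℕ) → VVec V k) : (k : ℕ) → VVec V k :=
  let s₀ : State V :=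
    { u := u, ubar := fun k => auxBar V κ u (L - 1 - k) k, util := auxTilde V u }
  let s₁ := (List.range L).reverse.foldl (downStep V κ ω f) s₀
  let s₂ := (List.range L).foldl (upStep V L κ ω f) s₁
  s₂.u

/-- `m` sweeps started from zero, as a vector indexed by all degrees of freedom. -/
def llmgIterate {N : ℕ} (V : Selection N) (L : ℕ) (κ f : ℝ × ℝ → ℝ) (ω : ℕ → ℝ) (m : ℕ) :
    Dof V L → ℝ :=
  fun p => ((llmg V L κ ω (load V f))^[m] 0) p.1 p.2

/-! ### Convolutional neural networks -/

/-- The activation function is locally essentially bounded, and three times continuously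
differentiable near some point at which its second derivative does not vanish. -/
def IsAdmissibleActivation (σ : ℝ → ℝ) : Prop :=
  (∀ R : ℝ, MemLp σ ⊤ (volume.restrict (Set.Icc (-R) R))) ∧
    ∃ x₀ : ℝ, ContDiffAt ℝ 3 σ x₀ ∧ iteratedDeriv 2 σ x₀ ≠ 0

/-- The types of convolution: vanilla, with stride two (from level `k + 1` to level `k`),
transpose with stride two (from level `k - 1` to level `k`), and submanifold sparse. -/
inductive ConvKind
  | vanilla
  | strided
  | transposed
  | sparse

/-- The fixed `0/1`-masks that an output image can be multiplied with: none, the indicator of the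
selected nodes, the indicator of their closure. -/
inductive MaskKind
  | none
  | selected
  | closure

/-- One unit of a network, i.e. one output channel of a convolutional layer.  It reads the channels
`sources` (of its own level, or of the next finer or next coarser level, depending on `kind`),
convolves each with a kernel of odd width and height `2 * radius + 1`, sums up, adds a bias, applies
the activation function or not, applies a mask, and stores the result as channel `target` of level
`level`. -/
structure ConvUnit (L : ℕ) where
  level : Fin L
  target : ℕ
  kind : ConvKind
  sources : Finset ℕ
  radius : ℕ
  kernel : ℕ → ℤ × ℤ → ℝ
  bias : ℝ
  useActivation : Bool
  mask : MaskKind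

/-- All kernel entries (zero or not) and the bias are counted. -/
def ConvUnit.numWeights {L : ℕ} (U : ConvUnit L) : ℕ :=
  U.sources.card * (2 * U.radius + 1) ^ 2 + 1

/-- The kernel for a source channel, cut off outside its window. -/
def ConvUnit.entry {L : ℕ} (U : ConvUnit L) (c : ℕ) (a b : ℤ) : ℝ :=
  if |a| ≤ (U.radius : ℤ) ∧ |b| ≤ (U.radius : ℤ) then U.kernel c (a, b) else 0

/-- The images present in a network: countably many channels on each level. -/
abbrev Features (N : ℕ) : Type := (k : ℕ) → ℕ → Image N k

/-- Plain convolution on level `k` (zero padding). -/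
def vanillaConv {N : ℕ} (S : Finset ℕ) (w : ℕ → ℤ → ℤ → ℝ) (x : Features N) (k : ℕ) : Image N k :=
  fun i => ∑ c ∈ S, ∑ j : Node N k,
    w c ((j.1.val : ℤ) - (i.1.val : ℤ)) ((j.2.val : ℤ) - (i.2.val : ℤ)) * x k c j

/-- The kernel is applied at every other pixel of the images of level `k + 1`. -/
def stridedConv {N : ℕ} (S : Finset ℕ) (w : ℕ → ℤ → ℤ → ℝ) (x : Features N) (k : ℕ) : Image N k :=
  fun i => ∑ c ∈ S, ∑ j : Node N (k + 1),
    w c ((j.1.val : ℤ) - 2 * (i.1.val : ℤ)) ((j.2.val : ℤ) - 2 * (i.2.val : ℤ)) * x (k + 1) c j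

/-- The kernel is swept over the images of the next coarser level, dilated by zeros between every
two pixels (on the coarsest level there is nothing to read). -/
def transposedConv {N : ℕ} (S : Finset ℕ) (w : ℕ → ℤ → ℤ → ℝ) (x : Features N) :
    (k : ℕ) → Image N k
  | 0 => 0
  | k + 1 => fun i => ∑ c ∈ S, ∑ j : Node N k,
      w c (2 * (j.1.val : ℤ) - (i.1.val : ℤ)) (2 * (j.2.val : ℤ) - (i.2.val : ℤ)) * x k c j

/-- Whether a pixel is kept by the unit.  A submanifold sparse convolution acts only at pixels at
which some input channel is nonzero; a mask keeps only its own pixels. -/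
def ConvUnit.Keeps {L N : ℕ} (U : ConvUnit L) (V : Selection N) (x : Features N)
    (i : Node N U.level) : Prop :=
  (match U.kind with
    | .sparse => ∃ c ∈ U.sources, x U.level c i ≠ 0
    | _ => True) ∧
  (match U.mask with
    | .none => True
    | .selected => i ∈ V U.level
    | .closure => i ∈ closureNodes V U.level)

open Classical in
/-- The output image of a unit. -/
def ConvUnit.output {L N : ℕ} (U : ConvUnit L) (σ : ℝ → ℝ) (V : Selection N) (x : Features N) :
    Image N U.level :=
  fun i =>
    if U.Keeps V x i then
      let z := (match U.kind with
        | .vanilla => vanillaConv U.sources U.entry x U.level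
        | .strided => stridedConv U.sources U.entry x U.level
        | .transposed => transposedConv U.sources U.entry x U.level
        | .sparse => vanillaConv U.sources U.entry x U.level) i + U.bias
      if U.useActivation then σ z else z
    else 0

/-- A unit stores its output; all other images are handed on (skip connections). -/
def ConvUnit.apply {L N : ℕ} (σ : ℝ → ℝ) (V : Selection N) (x : Features N) (U : ConvUnit L) :
    Features N :=
  Function.update x U.level (Function.update (x U.level) U.target (U.output σ V x))

/-- A convolutional network on the image sizes of the levels `0, …, L - 1`: finitely many
convolutional units, evaluated one after the other, and on each level a channel that holds the
output. -/
structure CNN (L : ℕ) where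
  units : List (ConvUnit L)
  out : Fin L → ℕ

/-- The number of weights of a network. -/
def CNN.numWeights {L : ℕ} (Ψ : CNN L) : ℕ := (Ψ.units.map ConvUnit.numWeights).sum

/-- The two input images are channels `0` and `1` of the finest level; all other channels are empty
(zero) before they are written. -/
def inputFeatures {N : ℕ} (L : ℕ) (a b : Image N (L - 1)) : Features N :=
  Function.update 0 (L - 1) (Function.update (Function.update 0 0 a) 1 b)

/-- The function realized by a network: two images of the finest level are mapped to coefficients
on the selected nodes of all levels. -/
def CNN.realize {L N : ℕ} (Ψ : CNN L) (σ : ℝ → ℝ) (V : Selection N) (a b : Image N (L - 1)) :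
    Dof V L → ℝ :=
  fun p => (Ψ.units.foldl (ConvUnit.apply σ V) (inputFeatures L a b)) p.1 (Ψ.out p.1) p.2.1

end LocalMultigrid

end

noncomputable section

namespace LocalMultigrid

open MeasureTheory Matrix Filter Topology Asymptotics

/-! ### The reference hat function -/

/-! Apart from pointwise products, one sweep consists of translation-invariant linear maps with `3 ×
3` stencils, on one level or between neighbouring levels, followed by a restriction to the selected
nodes or their closure. Convolutional units with masks perform these maps exactly. So two things
have to be explained: where the operator and load entries come from, and how a network multiplies.

Entries. Since `κ` and `f` are finite element functions of the finest level, the operator entries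
there, sorted into nine images by the direction of the neighbour, are convolutions of the
coefficients of `κ` with fixed kernels. Likewise for the load (`opCoeff_finest`,
`loadCoeff_finest`). This needs only that the hat function of an interior node is supported in the
square, so that integrals over the square become integrals over the plane and translation applies. A
hat function is a fixed combination of seven hat functions of the refined grid (`refHat_refine`).
Inserting this into both arguments of the bilinear form gives the entries of a level as strided
convolutions of those one level finer (`opCoeff_coarsen`). All levels thus cost a bounded number of
weights each. Nodes on the boundary may carry wrong entries, but interior nodes never read them.

Products. The combination `σ(x₀ + δ(g+h)) + σ(x₀ - δ(g+h)) - σ(x₀ + δ(g-h)) - σ(x₀ - δ(g-h))` equals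
`4 σ''(x₀) δ² g h` up to `o(δ²)`, so four activated units and one linear unit multiply approximately
(`Approximates.mul`). A single parameter `δ` serves all products in the network. Each channel
converges uniformly over the inputs to a bounded limit as `δ → 0`, a property preserved by sums,
fixed linear maps and approximate products. Hence no error has to be propagated quantitatively
through the sweeps.

Counting. `Computes` records additive weight costs and keeps every image computed so far. With this
calculus the algorithm is followed step by step: 748 weights per level for the entries, and 4804 per
level and sweep (`computes_llmg`). Finally, all eigenvalues are at most `C₀` and there are finitely
many coefficients, so uniform convergence of the coefficients gives convergence in the energy norm.
-/

/-- The hat function of the origin on the lattice with unit mesh width. -/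
def refHat (s t : ℝ) : ℝ := max 0 (1 - max (max |s| |t|) |s - t|)

theorem refHat_nonneg (s t : ℝ) : 0 ≤ refHat s t := le_max_left _ _

theorem refHat_eq_zero {s t : ℝ} (h : 1 ≤ |s| ∨ 1 ≤ |t| ∨ 1 ≤ |s - t|) : refHat s t = 0 := by
  refine max_eq_left (sub_nonpos.2 ?_)
  rcases h with h | h | h
  · exact le_max_of_le_left (le_max_of_le_left h)
  · exact le_max_of_le_left (le_max_of_le_right h)
  · exact le_max_of_le_right h

theorem refHat_eq_one_sub {s t c : ℝ} (hc : c ≤ 1) (h : max (max |s| |t|) |s - t| = c) :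
    refHat s t = 1 - c := by
  rw [refHat, h, max_eq_right (by linarith)]

theorem refHat_swap (s t : ℝ) : refHat s t = refHat t s := by
  rw [refHat, refHat, max_comm |s|, abs_sub_comm]

theorem refHat_of_nonneg {s t : ℝ} (ht : 0 ≤ t) (hts : t ≤ s) (hs : s ≤ 1) :
    refHat s t = 1 - s := by
  refine refHat_eq_one_sub hs ?_
  rw [abs_of_nonneg ht, abs_of_nonneg (ht.trans hts), abs_of_nonneg (sub_nonneg.2 hts),
    max_eq_left hts, max_eq_left (by linarith)]

theorem refHat_of_nonpos {s t : ℝ} (hs : s ≤ 0) (hts : t ≤ s) (ht : -1 ≤ t) :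
    refHat s t = 1 + t := by
  rw [refHat_eq_one_sub (c := -t) (by linarith), sub_neg_eq_add]
  rw [abs_of_nonpos hs, abs_of_nonpos (hts.trans hs), abs_of_nonneg (sub_nonneg.2 hts)]
  exact le_antisymm (max_le (max_le (by linarith) le_rfl) (by linarith))
    (le_max_of_le_left (le_max_right _ _))

/-- The values of all hat functions on the lower right triangle of the reference cell. -/
theorem refHat_lower_triangle {p q : ℝ} (hq : 0 ≤ q) (hqp : q ≤ p) (hp : p ≤ 1) (a b : ℤ) :
    refHat (p - a) (q - b) =
      if a = 0 ∧ b = 0 then 1 - p else if a = 1 ∧ b = 0 then p - q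
      else if a = 1 ∧ b = 1 then q else 0 := by
  split_ifs with h1 h2 h3
  · rw [h1.1, h1.2]; simpa using refHat_of_nonneg hq hqp hp
  · rw [h2.1, h2.2]; push_cast
    rw [refHat_swap, refHat_eq_one_sub (c := 1 - p + q) (by linarith)]
    · ring
    · rw [abs_of_nonneg (by linarith : (0:ℝ) ≤ q - 0), abs_of_nonpos (by linarith : p - 1 ≤ 0),
        abs_of_nonneg (by linarith)]
      rw [max_eq_right (max_le (by linarith) (by linarith))]; ring
  · rw [h3.1, h3.2]; push_cast
    rw [refHat_of_nonpos (by linarith) (by linarith) (by linarith)]; ring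
  · refine refHat_eq_zero ?_
    by_cases ha : a = 0 ∨ a = 1
    · by_cases hb : b = 0 ∨ b = 1
      · have : a = 0 ∧ b = 1 := by omega
        right; right
        rw [this.1, this.2]; push_cast
        exact le_abs.2 (Or.inl (by linarith))
      · right; left
        have : b ≤ -1 ∨ 2 ≤ b := by omega
        rcases this with h | h
        · have : (b : ℝ) ≤ -1 := by exact_mod_cast h
          exact le_abs.2 (Or.inl (by linarith))
        · have : (2 : ℝ) ≤ b := by exact_mod_cast h
          exact le_abs.2 (Or.inr (by linarith))
    · left
      have : a ≤ -1 ∨ 2 ≤ a := by omega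
      rcases this with h | h
      · have : (a : ℝ) ≤ -1 := by exact_mod_cast h
        exact le_abs.2 (Or.inl (by linarith))
      · have : (2 : ℝ) ≤ a := by exact_mod_cast h
        exact le_abs.2 (Or.inr (by linarith))

/-! ### Refinement equation of the hat function. -/

/-- The offsets of the `3 × 3` neighbourhood of a node. -/
def window : Finset (ℤ × ℤ) := Finset.Icc (-1) 1 ×ˢ Finset.Icc (-1) 1

theorem mem_window {a : ℤ × ℤ} : a ∈ window ↔ |a.1| ≤ 1 ∧ |a.2| ≤ 1 := by
  simp [window, abs_le]

theorem sum_window (g : ℤ × ℤ → ℝ) : ∑ a ∈ window, g a =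
    (g (-1, -1) + g (-1, 0) + g (-1, 1)) + (g (0, -1) + g (0, 0) + g (0, 1)) +
      (g (1, -1) + g (1, 0) + g (1, 1)) := by
  have h : (Finset.Icc (-1) 1 : Finset ℤ) = {-1, 0, 1} := by decide
  rw [window, Finset.sum_product, h]
  simp [add_assoc]

/-- The values of a hat function at the nodes of the once refined grid. -/
def prolongWeight (a : ℤ × ℤ) : ℝ := refHat (a.1 / 2) (a.2 / 2)

theorem prolongWeight_eq_zero {a : ℤ × ℤ} (h : a ∉ window) : prolongWeight a = 0 := by
  have key : ∀ b : ℤ, ¬ |b| ≤ 1 → 1 ≤ |(b : ℝ) / 2| := by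
    intro b hb
    rw [abs_div, abs_two, le_div_iff₀ two_pos, one_mul]
    exact_mod_cast (by omega : 2 ≤ |b|)
  rw [mem_window, not_and_or] at h
  refine refHat_eq_zero ?_
  rcases h with h | h
  · exact Or.inl (key _ h)
  · exact Or.inr (Or.inl (key _ h))

/-- The two corners of the window off the cutting diagonal lie on the boundary of the hexagonal
support, which leaves seven of the nine weights. -/
theorem sum_prolongWeight (g : ℤ × ℤ → ℝ) : ∑ a ∈ window, prolongWeight a * g a =
    g (0, 0) + (g (1, 0) + g (-1, 0) + g (0, 1) + g (0, -1) + g (1, 1) + g (-1, -1)) / 2 := by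
  have e1 : prolongWeight (0, 0) = 1 := by norm_num [prolongWeight, refHat]
  have e2 : prolongWeight (1, 0) = 1 / 2 := by norm_num [prolongWeight, refHat, abs_of_pos]
  have e3 : prolongWeight (-1, 0) = 1 / 2 := by norm_num [prolongWeight, refHat, abs_of_neg]
  have e4 : prolongWeight (0, 1) = 1 / 2 := by norm_num [prolongWeight, refHat, abs_of_pos]
  have e5 : prolongWeight (0, -1) = 1 / 2 := by norm_num [prolongWeight, refHat, abs_of_neg]
  have e6 : prolongWeight (1, 1) = 1 / 2 := by norm_num [prolongWeight, refHat, abs_of_pos]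
  have e7 : prolongWeight (-1, -1) = 1 / 2 := by norm_num [prolongWeight, refHat, abs_of_neg]
  have e8 : prolongWeight (1, -1) = 0 := by norm_num [prolongWeight, refHat]
  have e9 : prolongWeight (-1, 1) = 0 := by norm_num [prolongWeight, refHat]
  rw [sum_window, e1, e2, e3, e4, e5, e6, e7, e8, e9]
  ring

/-- Both sides are affine on each triangle of the half-size mesh. Integer and fractional parts of
`(2 * s, 2 * t)` locate the triangle, and on a lower right one `refHat_lower_triangle` evaluates
every fine hat function. -/
theorem refHat_refine_lower {s t : ℝ} (h : Int.fract (2 * t) ≤ Int.fract (2 * s)) :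
    refHat s t = ∑ a ∈ window, prolongWeight a * refHat (2 * s - a.1) (2 * t - a.2) := by
  have hq := Int.fract_nonneg (2 * t)
  have hp := (Int.fract_lt_one (2 * s)).le
  have key : ∀ a b : ℤ, refHat (2 * s - a) (2 * t - b) =
      if a - ⌊2 * s⌋ = 0 ∧ b - ⌊2 * t⌋ = 0 then 1 - Int.fract (2 * s)
      else if a - ⌊2 * s⌋ = 1 ∧ b - ⌊2 * t⌋ = 0 then Int.fract (2 * s) - Int.fract (2 * t)
      else if a - ⌊2 * s⌋ = 1 ∧ b - ⌊2 * t⌋ = 1 then Int.fract (2 * t) else 0 := fun a b => by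
    rw [← refHat_lower_triangle hq h hp, Int.fract, Int.fract]
    push_cast
    congr 1 <;> ring
  rw [sum_prolongWeight]
  simp only [key]
  have hs := Int.floor_add_fract (2 * s)
  have ht := Int.floor_add_fract (2 * t)
  generalize Int.fract (2 * s) = p at *
  generalize Int.fract (2 * t) = q at *
  generalize ⌊2 * s⌋ = m at *
  generalize ⌊2 * t⌋ = l at *
  obtain rfl : s = (m + p) / 2 := by linarith
  obtain rfl : t = (l + q) / 2 := by linarith
  clear key hs ht
  -- Cells with a corner coordinate outside `-2, …, 1` do not meet the interior of the coarse
  -- support, so both sides vanish there.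
  have hout : ∀ (b : ℤ) (r : ℝ), 0 ≤ r → r ≤ 1 → (b < -2 ∨ 1 < b) → 1 ≤ |((b : ℝ) + r) / 2| := by
    intro b r h0 h1 hb
    rcases hb with hb | hb
    · have : (b : ℝ) ≤ -3 := by exact_mod_cast (by omega : b ≤ -3)
      exact le_abs.2 (Or.inr (by linarith))
    · have : (2 : ℝ) ≤ b := by exact_mod_cast hb
      exact le_abs.2 (Or.inl (by linarith))
  by_cases hm : m < -2 ∨ 1 < m
  · rw [refHat_eq_zero (Or.inl (hout m p (hq.trans h) hp hm))]
    repeat rw [if_neg (by omega)]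
    norm_num
  by_cases hl : l < -2 ∨ 1 < l
  · rw [refHat_eq_zero (Or.inr (Or.inl (hout l q hq (h.trans hp) hl)))]
    repeat rw [if_neg (by omega)]
    norm_num
  have hm1 : -2 ≤ m := by omega
  have hm2 : m ≤ 1 := by omega
  have hl1 : -2 ≤ l := by omega
  have hl2 : l ≤ 1 := by omega
  -- Sixteen half-size cells remain, each an elementary identity in `p` and `q`.
  interval_cases m <;> interval_cases l <;> norm_num <;> simp only [refHat] <;> grind

/-- Hat functions are combinations of the hat functions of the once refined grid. -/
theorem refHat_refine (s t : ℝ) :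
    refHat s t = ∑ a ∈ window, prolongWeight a * refHat (2 * s - a.1) (2 * t - a.2) := by
  rcases le_total (Int.fract (2 * t)) (Int.fract (2 * s)) with h | h
  · exact refHat_refine_lower h
  -- Reflection in the diagonal exchanges the two kinds of triangles and preserves the weights.
  · rw [refHat_swap, refHat_refine_lower h, sum_prolongWeight, sum_prolongWeight]
    simp only [refHat_swap (2 * t - _)]
    ring

/-! ### Linearity of the variational form -/

/-- The hat function of the lattice point `i` on the lattice with mesh width `1 / n`. -/
def latticeHat (n : ℝ) (i : ℤ × ℤ) (x : ℝ × ℝ) : ℝ := refHat (n * x.1 - i.1) (n * x.2 - i.2)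

/-- A node as a lattice point. -/
def Node.toLattice {N k : ℕ} (i : Node N k) : ℤ × ℤ := ((i.1.val : ℤ), (i.2.val : ℤ))

/-- The number of cells in each direction. -/
def cells (N k : ℕ) : ℝ := (N : ℝ) * 2 ^ k

theorem hat_eq_latticeHat (N k : ℕ) (i : Node N k) :
    hat N k i = latticeHat (cells N k) (Node.toLattice i) := by
  funext x
  simp [hat, latticeHat, refHat, Node.toLattice, cells]

theorem latticeHat_nonneg (n : ℝ) (i : ℤ × ℤ) (x : ℝ × ℝ) : 0 ≤ latticeHat n i x :=
  refHat_nonneg _ _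

theorem latticeHat_refine (n : ℝ) (i : ℤ × ℤ) :
    latticeHat n i = fun x => ∑ a ∈ window, prolongWeight a * latticeHat (2 * n) (2 • i + a) x := by
  funext x
  rw [latticeHat, refHat_refine]
  refine Finset.sum_congr rfl fun a _ => ?_
  simp only [latticeHat, two_nsmul, Prod.fst_add, Prod.snd_add]
  push_cast
  congr 2 <;> ring

/-- The Lipschitz property is the only regularity needed below: it bounds the partial derivatives
and, by Rademacher's theorem, makes them additive almost everywhere. -/
theorem lipschitz_latticeHat (n : ℝ) (i : ℤ × ℤ) : ∃ K, LipschitzWith K (latticeHat n i) := by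
  have h1 : ∃ K, LipschitzWith K fun x : ℝ × ℝ => n * x.1 - i.1 :=
    ⟨_, ((lipschitzWith_smul n).comp LipschitzWith.prod_fst).sub (LipschitzWith.const _)⟩
  have h2 : ∃ K, LipschitzWith K fun x : ℝ × ℝ => n * x.2 - i.2 :=
    ⟨_, ((lipschitzWith_smul n).comp LipschitzWith.prod_snd).sub (LipschitzWith.const _)⟩
  obtain ⟨K₁, h1⟩ := h1
  obtain ⟨K₂, h2⟩ := h2
  have habs : LipschitzWith 1 (fun s : ℝ => |s|) := lipschitzWith_one_norm
  exact ⟨_, (((LipschitzWith.const 1).sub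
    (((habs.comp h1).max (habs.comp h2)).max (habs.comp (h1.sub h2)))).const_max 0)⟩

theorem gradDot_comm (u w : ℝ × ℝ → ℝ) : gradDot u w = gradDot w u := by
  funext x
  rw [gradDot, gradDot]
  ring

theorem darcyForm_comm (κ u w : ℝ × ℝ → ℝ) : darcyForm κ u w = darcyForm κ w u := by
  rw [darcyForm, darcyForm, gradDot_comm]

theorem lipschitz_slice_fst {K : NNReal} {u : ℝ × ℝ → ℝ} (hu : LipschitzWith K u) (t : ℝ) :
    LipschitzWith K fun s => u (s, t) := by
  simpa [Function.comp_def] using hu.comp (LipschitzWith.prodMk_right t)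

theorem lipschitz_slice_snd {K : NNReal} {u : ℝ × ℝ → ℝ} (hu : LipschitzWith K u) (s : ℝ) :
    LipschitzWith K fun t => u (s, t) := by
  simpa [Function.comp_def] using hu.comp (LipschitzWith.prodMk_left s)

theorem measurable_gradDot {u w : ℝ × ℝ → ℝ} (hu : Continuous u) (hw : Continuous w) :
    Measurable (gradDot u w) := by
  have h1 : ∀ v : ℝ × ℝ → ℝ, Continuous v →
      Measurable fun x : ℝ × ℝ => deriv (fun s => v (s, x.2)) x.1 := fun v hv =>
    (measurable_deriv_with_param (f := fun t s => v (s, t)) (hv.comp continuous_swap)).comp measurable_swap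
  have h2 : ∀ v : ℝ × ℝ → ℝ, Continuous v →
      Measurable fun x : ℝ × ℝ => deriv (fun t => v (x.1, t)) x.2 := fun v hv =>
    measurable_deriv_with_param (f := fun s t => v (s, t)) hv
  exact ((h1 u hu).mul (h1 w hw)).add ((h2 u hu).mul (h2 w hw))

theorem abs_gradDot_le {K K' : NNReal} {u w : ℝ × ℝ → ℝ} (hu : LipschitzWith K u)
    (hw : LipschitzWith K' w) (x : ℝ × ℝ) : |gradDot u w x| ≤ 2 * (K * K') := by
  have h1 := norm_deriv_le_of_lipschitz (x₀ := x.1) (lipschitz_slice_fst hu x.2)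
  have h2 := norm_deriv_le_of_lipschitz (x₀ := x.1) (lipschitz_slice_fst hw x.2)
  have h3 := norm_deriv_le_of_lipschitz (x₀ := x.2) (lipschitz_slice_snd hu x.1)
  have h4 := norm_deriv_le_of_lipschitz (x₀ := x.2) (lipschitz_slice_snd hw x.1)
  rw [gradDot, two_mul]
  refine (abs_add_le _ _).trans (add_le_add ?_ ?_) <;> rw [abs_mul]
  · exact mul_le_mul h1 h2 (abs_nonneg _) K.2
  · exact mul_le_mul h3 h4 (abs_nonneg _) K.2

theorem measurableSet_unitSquare : MeasurableSet unitSquare :=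
  measurableSet_Ioo.prod measurableSet_Ioo

theorem volume_unitSquare_ne_top : volume unitSquare ≠ ⊤ := by
  rw [unitSquare, Measure.volume_eq_prod, Measure.prod_prod]
  simp

theorem exists_bound_on_unitSquare {κ : ℝ × ℝ → ℝ} (hκ : Continuous κ) :
    ∃ B, ∀ x ∈ unitSquare, |κ x| ≤ B := by
  obtain ⟨B, hB⟩ := (isCompact_Icc.prod isCompact_Icc :
    IsCompact (Set.Icc (0 : ℝ) 1 ×ˢ Set.Icc (0 : ℝ) 1)).exists_bound_of_continuousOn
      hκ.continuousOn
  exact ⟨B, fun x hx => hB x ⟨Set.Ioo_subset_Icc_self hx.1, Set.Ioo_subset_Icc_self hx.2⟩⟩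

theorem integrableOn_unitSquare {κ : ℝ × ℝ → ℝ} (hκ : Continuous κ) :
    IntegrableOn κ unitSquare := by
  obtain ⟨B, hB⟩ := exists_bound_on_unitSquare hκ
  exact Measure.integrableOn_of_bounded (M := B) volume_unitSquare_ne_top
    hκ.aestronglyMeasurable
    ((ae_restrict_iff' measurableSet_unitSquare).2 (Filter.Eventually.of_forall hB))

theorem integrableOn_mul_gradDot {κ u w : ℝ × ℝ → ℝ} (hκ : Continuous κ)
    (hu : ∃ K, LipschitzWith K u) (hw : ∃ K, LipschitzWith K w) :
    IntegrableOn (fun x => κ x * gradDot u w x) unitSquare := by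
  obtain ⟨K, hu⟩ := hu
  obtain ⟨K', hw⟩ := hw
  obtain ⟨B, hB⟩ := exists_bound_on_unitSquare hκ
  refine Measure.integrableOn_of_bounded (M := B * (2 * (K * K'))) volume_unitSquare_ne_top
    (hκ.aestronglyMeasurable.mul
      (measurable_gradDot hu.continuous hw.continuous).aestronglyMeasurable)
    ((ae_restrict_iff' measurableSet_unitSquare).2 (Filter.Eventually.of_forall fun x hx => ?_))
  rw [norm_mul]
  exact mul_le_mul (hB x hx) (abs_gradDot_le hu hw x) (abs_nonneg _)
    ((abs_nonneg _).trans (hB x hx))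

theorem darcyForm_sum_coefficient {ι : Type*} (s : Finset ι) (c : ι → ℝ) (κ : ι → ℝ × ℝ → ℝ)
    {u w : ℝ × ℝ → ℝ} (hκ : ∀ l ∈ s, Continuous (κ l))
    (hu : ∃ K, LipschitzWith K u) (hw : ∃ K, LipschitzWith K w) :
    darcyForm (fun x => ∑ l ∈ s, c l * κ l x) u w = ∑ l ∈ s, c l * darcyForm (κ l) u w := by
  simp only [darcyForm, Finset.sum_mul, mul_assoc]
  rw [integral_finsetSum]
  · simp only [integral_const_mul]
  · exact fun l hl => (integrableOn_mul_gradDot (hκ l hl) hu hw).const_mul _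

/-- `deriv` is additive only at points of differentiability; Rademacher's theorem makes the
exceptional set null, which is harmless under the integral. -/
theorem gradDot_sum_ae {ι : Type*} (s : Finset ι) (c : ι → ℝ) (u : ι → ℝ × ℝ → ℝ)
    (w : ℝ × ℝ → ℝ) (hu : ∀ l ∈ s, ∃ K, LipschitzWith K (u l)) :
    ∀ᵐ x, gradDot (fun x => ∑ l ∈ s, c l * u l x) w x = ∑ l ∈ s, c l * gradDot (u l) w x := by
  have h : ∀ᵐ x, ∀ l ∈ s, DifferentiableAt ℝ (u l) x :=
    (Finset.eventually_all s).2 fun l hl => (hu l hl).choose_spec.ae_differentiableAt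
  filter_upwards [h] with x hx
  have h1 : ∀ l ∈ s, DifferentiableAt ℝ (fun r => u l (r, x.2)) x.1 := fun l hl =>
    DifferentiableAt.comp (g := u l) (f := fun r : ℝ => (r, x.2)) x.1 (hx l hl)
      (differentiableAt_id.prodMk (differentiableAt_const _))
  have h2 : ∀ l ∈ s, DifferentiableAt ℝ (fun r => u l (x.1, r)) x.2 := fun l hl =>
    DifferentiableAt.comp (g := u l) (f := fun r : ℝ => (x.1, r)) x.2 (hx l hl)
      ((differentiableAt_const _).prodMk differentiableAt_id)
  simp only [gradDot]
  rw [deriv_fun_sum fun l hl => (h1 l hl).const_mul _,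
    deriv_fun_sum fun l hl => (h2 l hl).const_mul _, Finset.sum_mul, Finset.sum_mul,
    ← Finset.sum_add_distrib]
  refine Finset.sum_congr rfl fun l hl => ?_
  rw [deriv_const_mul _ (h1 l hl), deriv_const_mul _ (h2 l hl)]
  ring

theorem darcyForm_sum_left {ι : Type*} (s : Finset ι) (c : ι → ℝ) (u : ι → ℝ × ℝ → ℝ)
    {κ w : ℝ × ℝ → ℝ} (hκ : Continuous κ) (hu : ∀ l ∈ s, ∃ K, LipschitzWith K (u l))
    (hw : ∃ K, LipschitzWith K w) :
    darcyForm κ (fun x => ∑ l ∈ s, c l * u l x) w = ∑ l ∈ s, c l * darcyForm κ (u l) w := by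
  have h : darcyForm κ (fun x => ∑ l ∈ s, c l * u l x) w =
      ∫ x in unitSquare, ∑ l ∈ s, c l * (κ x * gradDot (u l) w x) := by
    refine setIntegral_congr_ae measurableSet_unitSquare ?_
    filter_upwards [gradDot_sum_ae s c u w hu] with x hx _
    rw [hx, Finset.mul_sum]
    exact Finset.sum_congr rfl fun l _ => by ring
  rw [h, integral_finsetSum]
  · simp only [integral_const_mul, darcyForm]
  · exact fun l hl => (integrableOn_mul_gradDot hκ (hu l hl) hw).const_mul _

/-! ### Locality and translation invariance -/

theorem abs_lt_one_of_refHat_ne_zero {s t : ℝ} (h : refHat s t ≠ 0) : |s| < 1 ∧ |t| < 1 := by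
  by_contra hc
  rw [not_and_or, not_lt, not_lt] at hc
  exact h (refHat_eq_zero (by tauto))

theorem latticeHat_sub_mem_window {n : ℝ} {i j : ℤ × ℤ} {x : ℝ × ℝ} (hi : latticeHat n i x ≠ 0)
    (hj : latticeHat n j x ≠ 0) : j - i ∈ window := by
  have h1 := abs_lt_one_of_refHat_ne_zero hi
  have h2 := abs_lt_one_of_refHat_ne_zero hj
  simp only [abs_lt] at h1 h2
  rw [mem_window, abs_le, abs_le, Prod.fst_sub, Prod.snd_sub]
  have key : ∀ a b : ℤ, (a : ℝ) < b + 2 → a - b ≤ 1 := fun a b h => by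
    have : a < b + 2 := by exact_mod_cast h
    omega
  have := key i.1 j.1 (by linarith)
  have := key j.1 i.1 (by linarith)
  have := key i.2 j.2 (by linarith)
  have := key j.2 i.2 (by linarith)
  omega

/-- A zero of a nonnegative function is a minimum, so both partial `deriv`s vanish there, even at
kinks, where `deriv` is zero by default. Locality therefore holds at every point and not just almost
everywhere. -/
theorem gradDot_eq_zero_left {u w : ℝ × ℝ → ℝ} (hu : ∀ x, 0 ≤ u x) {x : ℝ × ℝ} (h : u x = 0) :
    gradDot u w x = 0 := by
  have h1 : deriv (fun s => u (s, x.2)) x.1 = 0 :=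
    IsLocalMin.deriv_eq_zero (Filter.Eventually.of_forall fun s => by simpa [h] using hu _)
  have h2 : deriv (fun t => u (x.1, t)) x.2 = 0 :=
    IsLocalMin.deriv_eq_zero (Filter.Eventually.of_forall fun s => by simpa [h] using hu _)
  rw [gradDot, h1, h2, zero_mul, zero_mul, add_zero]

theorem gradDot_latticeHat_eq_zero {n : ℝ} {i j : ℤ × ℤ} {x : ℝ × ℝ}
    (h : latticeHat n i x = 0 ∨ latticeHat n j x = 0) :
    gradDot (latticeHat n i) (latticeHat n j) x = 0 := by
  rcases h with h | h
  · exact gradDot_eq_zero_left (latticeHat_nonneg n i) h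
  · rw [gradDot_comm]
    exact gradDot_eq_zero_left (latticeHat_nonneg n j) h

theorem darcyForm_eq_zero {κ : ℝ × ℝ → ℝ} {n : ℝ} {i j : ℤ × ℤ} (h : j - i ∉ window) :
    darcyForm κ (latticeHat n i) (latticeHat n j) = 0 := by
  have : ∀ x, κ x * gradDot (latticeHat n i) (latticeHat n j) x = 0 := fun x => by
    rw [gradDot_latticeHat_eq_zero, mul_zero]
    by_contra hc
    rw [not_or] at hc
    exact h (latticeHat_sub_mem_window hc.1 hc.2)
  simp [darcyForm, this]

theorem latticeHat_translate {n : ℝ} (hn : n ≠ 0) (i j : ℤ × ℤ) (x : ℝ × ℝ) :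
    latticeHat n i (x + (j.1 / n, j.2 / n)) = latticeHat n (i - j) x := by
  simp only [latticeHat, Prod.fst_add, Prod.snd_add, Prod.fst_sub, Prod.snd_sub]
  push_cast
  congr 1 <;> field_simp <;> ring

theorem gradDot_translate (u w : ℝ × ℝ → ℝ) (x a : ℝ × ℝ) :
    gradDot u w (x + a) = gradDot (fun y => u (y + a)) (fun y => w (y + a)) x := by
  have h1 : ∀ v : ℝ × ℝ → ℝ, deriv (fun s => v (s, (x + a).2)) (x + a).1 =
      deriv (fun s => v ((s, x.2) + a)) x.1 := fun v =>
    (deriv_comp_add_const (fun s => v (s, x.2 + a.2)) a.1 x.1).symm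
  have h2 : ∀ v : ℝ × ℝ → ℝ, deriv (fun s => v ((x + a).1, s)) (x + a).2 =
      deriv (fun s => v ((x.1, s) + a)) x.2 := fun v =>
    (deriv_comp_add_const (fun s => v (x.1 + a.1, s)) a.2 x.2).symm
  rw [gradDot, gradDot, h1, h1, h2, h2]

theorem mem_unitSquare_of_latticeHat_ne_zero {N k : ℕ} {i : Node N k} (hi : IsInterior i)
    {x : ℝ × ℝ} (h : latticeHat (cells N k) (Node.toLattice i) x ≠ 0) : x ∈ unitSquare := by
  obtain ⟨h1, h2⟩ := abs_lt_one_of_refHat_ne_zero h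
  obtain ⟨i1, i2, i3, i4⟩ := hi
  have hn : 0 < cells N k := by
    have : 0 < N * 2 ^ k := by omega
    rw [cells]; exact_mod_cast this
  have key : ∀ (a : ℕ) (r : ℝ), 0 < a → a < N * 2 ^ k → |cells N k * r - ((a : ℤ) : ℝ)| < 1 →
      r ∈ Set.Ioo (0 : ℝ) 1 := by
    intro a r h0 ha hr
    rw [abs_lt] at hr
    push_cast at hr
    have h0' : (1 : ℝ) ≤ a := by exact_mod_cast h0
    have ha' : (a : ℝ) + 1 ≤ cells N k := by rw [cells]; exact_mod_cast ha
    exact ⟨pos_of_mul_pos_right (by linarith : 0 < cells N k * r) hn.le,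
      lt_of_mul_lt_mul_left (by linarith : cells N k * r < cells N k * 1) hn.le⟩
  exact ⟨key _ _ i1 i2 h1, key _ _ i3 i4 h2⟩

/-- The entries of the operator for a hat function as coefficient. -/
def tripleWeight (n : ℝ) (d l : ℤ × ℤ) : ℝ :=
  ∫ x, latticeHat n l x * gradDot (latticeHat n 0) (latticeHat n d) x

/-- The entries of the mass matrix. -/
def massWeight (n : ℝ) (l : ℤ × ℤ) : ℝ := ∫ x, latticeHat n l x * latticeHat n 0 x

theorem tripleWeight_eq_zero {n : ℝ} {d l : ℤ × ℤ} (h : l ∉ window) : tripleWeight n d l = 0 := by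
  have : ∀ x, latticeHat n l x * gradDot (latticeHat n 0) (latticeHat n d) x = 0 := fun x => by
    by_contra hc
    rw [mul_eq_zero, not_or] at hc
    refine h (sub_zero l ▸ latticeHat_sub_mem_window (i := 0) (fun h0 => hc.2 ?_) hc.1)
    exact gradDot_latticeHat_eq_zero (Or.inl h0)
  simp [tripleWeight, this]

theorem massWeight_eq_zero {n : ℝ} {l : ℤ × ℤ} (h : l ∉ window) : massWeight n l = 0 := by
  have : ∀ x, latticeHat n l x * latticeHat n 0 x = 0 := fun x => by
    by_contra hc
    rw [mul_eq_zero, not_or] at hc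
    exact h (sub_zero l ▸ latticeHat_sub_mem_window hc.2 hc.1)
  simp [massWeight, this]

theorem cells_ne_zero_of_isInterior {N k : ℕ} {i : Node N k} (hi : IsInterior i) :
    cells N k ≠ 0 := by
  have : N * 2 ^ k ≠ 0 := by have := hi.2.1; omega
  rw [cells]
  exact_mod_cast this

/-- The integrand vanishes off the support of the interior hat function, hence off the square. The
integral may be taken over the plane and translated so that node `i` becomes the origin. -/
theorem darcyForm_latticeHat {N k : ℕ} {i : Node N k} (hi : IsInterior i) (l d : ℤ × ℤ) :
    darcyForm (latticeHat (cells N k) l) (latticeHat (cells N k) (Node.toLattice i))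
      (latticeHat (cells N k) (Node.toLattice i + d)) =
    tripleWeight (cells N k) d (l - Node.toLattice i) := by
  have hn := cells_ne_zero_of_isInterior hi
  rw [darcyForm, setIntegral_eq_integral_of_forall_compl_eq_zero, tripleWeight,
    ← integral_add_right_eq_self _ ((Node.toLattice i).1 / cells N k,
      (Node.toLattice i).2 / cells N k)]
  · simp only [gradDot_translate, latticeHat_translate hn, sub_self, add_sub_cancel_left]
  · intro x hx
    rw [gradDot_latticeHat_eq_zero, mul_zero]
    left
    by_contra hc
    exact hx (mem_unitSquare_of_latticeHat_ne_zero hi hc)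

theorem setIntegral_latticeHat_mul {N k : ℕ} {i : Node N k} (hi : IsInterior i) (l : ℤ × ℤ) :
    ∫ x in unitSquare, latticeHat (cells N k) l x * latticeHat (cells N k) (Node.toLattice i) x =
      massWeight (cells N k) (l - Node.toLattice i) := by
  have hn := cells_ne_zero_of_isInterior hi
  rw [setIntegral_eq_integral_of_forall_compl_eq_zero, massWeight,
    ← integral_add_right_eq_self _ ((Node.toLattice i).1 / cells N k,
      (Node.toLattice i).2 / cells N k)]
  · simp only [latticeHat_translate hn, sub_self]
  · intro x hx
    refine mul_eq_zero_of_right _ ?_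
    by_contra hc
    exact hx (mem_unitSquare_of_latticeHat_ne_zero hi hc)

/-! ### Stencils -/

theorem Node.toLattice_injective {N k : ℕ} :
    Function.Injective (Node.toLattice : Node N k → ℤ × ℤ) := by
  intro i j h
  rw [Node.toLattice, Node.toLattice, Prod.mk.injEq] at h
  exact Prod.ext (Fin.ext (by exact_mod_cast h.1)) (Fin.ext (by exact_mod_cast h.2))

/-- Plain convolution of an image. -/
def conv {N k : ℕ} (K : ℤ × ℤ → ℝ) (g : Image N k) : Image N k :=
  fun i => ∑ j, K (Node.toLattice j - Node.toLattice i) * g j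

/-- Convolution with stride two, to the next coarser level. -/
def convDown {N k : ℕ} (K : ℤ × ℤ → ℝ) (g : Image N (k + 1)) : Image N k :=
  fun i => ∑ j, K (Node.toLattice j - 2 • Node.toLattice i) * g j

/-- Transpose convolution with stride two, to the next finer level. -/
def convUp {N k : ℕ} (K : ℤ × ℤ → ℝ) (g : Image N k) : Image N (k + 1) :=
  fun i => ∑ j, K (2 • Node.toLattice j - Node.toLattice i) * g j

/-- The kernel of a shift. -/
def shiftKernel (d a : ℤ × ℤ) : ℝ := if a = d then 1 else 0

theorem shiftKernel_eq_zero {d a : ℤ × ℤ} (hd : d ∈ window) (ha : a ∉ window) :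
    shiftKernel d a = 0 :=
  if_neg fun (h : a = d) => ha (h ▸ hd)

theorem shiftKernel_neg (d a : ℤ × ℤ) : shiftKernel (-d) a = shiftKernel d (-a) := by
  simp only [shiftKernel, neg_eq_iff_eq_neg]

theorem conv_shiftKernel_zero {N k : ℕ} (g : Image N k) : conv (shiftKernel 0) g = g := by
  funext i
  rw [conv, Finset.sum_eq_single i]
  · simp [shiftKernel]
  · intro j _ hj
    rw [shiftKernel, if_neg, zero_mul]
    exact fun h => hj (Node.toLattice_injective (sub_eq_zero.1 h))
  · simp

theorem neg_mem_window {a : ℤ × ℤ} : -a ∈ window ↔ a ∈ window := by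
  simp [mem_window]

/-- The vanishing conditions turn both sides into sums over the whole lattice, which are translation
invariant. -/
theorem sum_window_shift (F : ℤ × ℤ → ℝ) (e : ℤ × ℤ) (h1 : ∀ b ∉ window, F b = 0)
    (h2 : ∀ b ∉ window, F (b + e) = 0) : ∑ b ∈ window, F b = ∑ b ∈ window, F (b + e) := by
  rw [← finsum_eq_sum_of_support_subset, ← finsum_eq_sum_of_support_subset]
  · exact (finsum_comp_equiv (Equiv.addRight e)).symm
  · intro b hb
    by_contra hc
    exact hb (h2 b hc)
  · intro b hb
    by_contra hc
    exact hb (h1 b hc)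

/-- The `3 × 3` neighbourhood of the fine copy of an interior coarse node lies entirely in the fine
grid, so zero padding cuts off nothing. -/
theorem sum_nodes_eq_sum_window {N k : ℕ} {i : Node N k} (hi : IsInterior i)
    (w G : ℤ × ℤ → ℝ) (hw : ∀ a ∉ window, w a = 0) :
    ∑ j : Node N (k + 1), w (Node.toLattice j - 2 • Node.toLattice i) * G (Node.toLattice j) =
      ∑ a ∈ window, w a * G (2 • Node.toLattice i + a) := by
  refine Finset.sum_bij_ne_zero (fun j _ _ => Node.toLattice j - 2 • Node.toLattice i) ?_ ?_ ?_ ?_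
  · intro j _ hj
    by_contra hc
    exact hj (by rw [hw _ hc, zero_mul])
  · intro j _ _ j' _ _ h
    exact Node.toLattice_injective (sub_left_injective h)
  · intro a ha hne
    obtain ⟨i1, i2, i3, i4⟩ := hi
    have ha' := mem_window.1 ha
    rw [abs_le, abs_le] at ha'
    have hpow : N * 2 ^ (k + 1) = 2 * (N * 2 ^ k) := by ring
    obtain ⟨j, key⟩ : ∃ j : Node N (k + 1), Node.toLattice j = 2 • Node.toLattice i + a := by
      refine ⟨(⟨(2 * (i.1.val : ℤ) + a.1).toNat, by omega⟩,
        ⟨(2 * (i.2.val : ℤ) + a.2).toNat, by omega⟩), ?_⟩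
      refine Prod.ext ?_ ?_ <;> simp [Node.toLattice] <;> omega
    refine ⟨j, Finset.mem_univ _, ?_, ?_⟩
    · rwa [key, add_sub_cancel_left]
    · rw [key, add_sub_cancel_left]
  · intro j _ _
    rw [add_sub_cancel]

/-- The fine neighbours of an interior coarse node are interior. -/
theorem isInterior_of_sub_mem_window {N k : ℕ} {i : Node N k} (hi : IsInterior i)
    {j : Node N (k + 1)} (h : Node.toLattice j - 2 • Node.toLattice i ∈ window) :
    IsInterior j := by
  obtain ⟨i1, i2, i3, i4⟩ := hi
  have h := mem_window.1 h
  have hpow : N * 2 ^ (k + 1) = 2 * (N * 2 ^ k) := by ring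
  simp only [Node.toLattice, two_nsmul, Prod.fst_sub, Prod.snd_sub, Prod.mk_add_mk, abs_le] at h
  refine ⟨?_, ?_, ?_, ?_⟩ <;> omega

/-! ### The operator and the load vector as images -/

theorem cells_succ (N k : ℕ) : cells N (k + 1) = 2 * cells N k := by
  rw [cells, cells, pow_succ]
  ring

/-- The entry of the operator for a node of level `k` and its neighbour in direction `d`. -/
def opCoeff (κ : ℝ × ℝ → ℝ) (N k : ℕ) (d i : ℤ × ℤ) : ℝ :=
  darcyForm κ (latticeHat (cells N k) i) (latticeHat (cells N k) (i + d))

/-- The entry of the load vector for a node of level `k`. -/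
def loadCoeff (f : ℝ × ℝ → ℝ) (N k : ℕ) (i : ℤ × ℤ) : ℝ :=
  ∫ x in unitSquare, f x * latticeHat (cells N k) i x

theorem continuous_latticeHat (n : ℝ) (i : ℤ × ℤ) : Continuous (latticeHat n i) :=
  (lipschitz_latticeHat n i).choose_spec.continuous

theorem feFun_eq (N k : ℕ) (c : Image N k) :
    feFun N k c = fun x => ∑ l, c l * latticeHat (cells N k) (Node.toLattice l) x := by
  funext x
  simp only [feFun, hat_eq_latticeHat]

theorem continuous_feFun (N k : ℕ) (c : Image N k) : Continuous (feFun N k c) := by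
  rw [feFun_eq]
  exact continuous_finsetSum _ fun l _ => continuous_const.mul (continuous_latticeHat _ _)

theorem opCoeff_finest {N k : ℕ} (c : Image N k) (d : ℤ × ℤ) {i : Node N k} (hi : IsInterior i) :
    opCoeff (feFun N k c) N k d (Node.toLattice i) = conv (tripleWeight (cells N k) d) c i := by
  rw [opCoeff, feFun_eq, darcyForm_sum_coefficient _ _ _ (fun l _ => continuous_latticeHat _ _)
    (lipschitz_latticeHat _ _) (lipschitz_latticeHat _ _), conv]
  refine Finset.sum_congr rfl fun l _ => ?_
  rw [darcyForm_latticeHat hi, mul_comm]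

theorem loadCoeff_finest {N k : ℕ} (c : Image N k) {i : Node N k} (hi : IsInterior i) :
    loadCoeff (feFun N k c) N k (Node.toLattice i) = conv (massWeight (cells N k)) c i := by
  simp only [loadCoeff, feFun_eq, Finset.sum_mul, mul_assoc]
  rw [integral_finsetSum, conv]
  · refine Finset.sum_congr rfl fun l _ => ?_
    rw [integral_const_mul, setIntegral_latticeHat_mul hi, mul_comm]
  · exact fun l _ => (integrableOn_unitSquare
      ((continuous_latticeHat _ _).mul (continuous_latticeHat _ _))).const_mul _

theorem loadCoeff_coarsen {f : ℝ × ℝ → ℝ} (hf : Continuous f) {N k : ℕ} {i : Node N k}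
    (hi : IsInterior i) : loadCoeff f N k (Node.toLattice i) =
      convDown prolongWeight (fun j => loadCoeff f N (k + 1) (Node.toLattice j)) i := by
  rw [convDown, sum_nodes_eq_sum_window hi _ _ fun a => prolongWeight_eq_zero]
  simp only [loadCoeff, latticeHat_refine (cells N k), cells_succ, Finset.mul_sum]
  rw [integral_finsetSum]
  · refine Finset.sum_congr rfl fun a _ => ?_
    rw [← integral_const_mul]
    exact integral_congr_ae (Filter.Eventually.of_forall fun x => by ring)
  · exact fun a _ => integrableOn_unitSquare
      (hf.mul (continuous_const.mul (continuous_latticeHat _ _)))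

/-- The kernels that compute the operator of level `k` from the operator of level `k + 1`. -/
def coarsenWeight (d d' a : ℤ × ℤ) : ℝ := prolongWeight a * prolongWeight (a + d' - 2 • d)

theorem coarsenWeight_eq_zero (d d' : ℤ × ℤ) {a : ℤ × ℤ} (h : a ∉ window) :
    coarsenWeight d d' a = 0 := by
  rw [coarsenWeight, prolongWeight_eq_zero h, zero_mul]

theorem opCoeff_eq_zero (κ : ℝ × ℝ → ℝ) (N k : ℕ) {d : ℤ × ℤ} (i : ℤ × ℤ) (h : d ∉ window) :
    opCoeff κ N k d i = 0 :=
  darcyForm_eq_zero (by rwa [add_sub_cancel_left])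

/-- This is the Galerkin property of nested spaces: the refinement equation is inserted into both
arguments, and the resulting pairs of fine nodes are sorted by their difference `d'`. -/
theorem opCoeff_coarsen {κ : ℝ × ℝ → ℝ} (hκ : Continuous κ) {N k : ℕ} {i : Node N k}
    (hi : IsInterior i) (d : ℤ × ℤ) : opCoeff κ N k d (Node.toLattice i) =
      ∑ d' ∈ window, convDown (coarsenWeight d d')
        (fun j => opCoeff κ N (k + 1) d' (Node.toLattice j)) i := by
  have h1 : ∀ d', convDown (coarsenWeight d d')
      (fun j => opCoeff κ N (k + 1) d' (Node.toLattice j)) i =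
      ∑ a ∈ window, coarsenWeight d d' a * opCoeff κ N (k + 1) d' (2 • Node.toLattice i + a) :=
    fun d' => sum_nodes_eq_sum_window hi _ _ fun a => coarsenWeight_eq_zero d d'
  simp only [h1]
  rw [Finset.sum_comm]
  generalize Node.toLattice i = I
  rw [opCoeff, latticeHat_refine (cells N k), ← cells_succ, darcyForm_sum_left _ _ _ hκ
    (fun _ _ => lipschitz_latticeHat _ _) (lipschitz_latticeHat _ _)]
  refine Finset.sum_congr rfl fun a _ => ?_
  rw [latticeHat_refine (cells N k), ← cells_succ, darcyForm_comm, darcyForm_sum_left _ _ _ hκ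
    (fun _ _ => lipschitz_latticeHat _ _) (lipschitz_latticeHat _ _), Finset.mul_sum]
  -- The fine nodes `2 • I + a` and `2 • (I + d) + b` differ by `d' = 2 • d + b - a`. The sum over
  -- `b` becomes a sum over `d'`, because prolongation weights vanish for `b` outside the window and
  -- fine entries for `d'` outside it.
  rw [sum_window_shift _ (a - 2 • d)]
  · refine Finset.sum_congr rfl fun d' _ => ?_
    rw [darcyForm_comm, coarsenWeight, opCoeff, mul_assoc, add_sub_assoc' d',
      add_comm d' a]
    congr 4
    module
  · intro b hb
    rw [prolongWeight_eq_zero hb]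
    ring
  · intro b hb
    rw [darcyForm_comm, darcyForm_eq_zero, mul_zero, mul_zero]
    rwa [show 2 • (I + d) + (b + (a - 2 • d)) - (2 • I + a) = b by module]

/-! ### The matrices of the algorithm as stencils -/

/-- Extension of a coefficient vector by zero to an image. -/
def toImage {N k : ℕ} (s : Finset (Node N k)) (v : {i // i ∈ s} → ℝ) : Image N k :=
  fun i => if h : i ∈ s then v ⟨i, h⟩ else 0

theorem toImage_of_mem {N k : ℕ} {s : Finset (Node N k)} (v : {i // i ∈ s} → ℝ) {i : Node N k}
    (h : i ∈ s) : toImage s v i = v ⟨i, h⟩ := dif_pos h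

theorem toImage_of_notMem {N k : ℕ} {s : Finset (Node N k)} (v : {i // i ∈ s} → ℝ) {i : Node N k}
    (h : i ∉ s) : toImage s v i = 0 := dif_neg h

theorem sum_mul_toImage {N k : ℕ} (s : Finset (Node N k)) (F : Node N k → ℝ)
    (v : {i // i ∈ s} → ℝ) : ∑ j : {i // i ∈ s}, F j.1 * v j = ∑ j, F j * toImage s v j := by
  rw [← Finset.sum_subset (Finset.subset_univ s) fun j _ hj => by
    rw [toImage_of_notMem v hj, mul_zero], ← Finset.sum_coe_sort s]
  exact Finset.sum_congr rfl fun j _ => by rw [toImage_of_mem v j.2]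

theorem toImage_zero {N k : ℕ} (s : Finset (Node N k)) : toImage s 0 = 0 := by
  funext i
  simp [toImage]

theorem toImage_add {N k : ℕ} (s : Finset (Node N k)) (v w : {i // i ∈ s} → ℝ) :
    toImage s (v + w) = toImage s v + toImage s w := by
  funext i
  by_cases h : i ∈ s <;> simp [toImage, h]

theorem subset_closureNodes {N : ℕ} (V : Selection N) (k : ℕ) : V k ⊆ closureNodes V k :=
  Finset.subset_union_left

theorem toImage_extend {N : ℕ} (V : Selection N) (k : ℕ) (u : VVec V k) :
    toImage (closureNodes V k) (extend V k u) = toImage (V k) u := by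
  funext i
  by_cases h : i ∈ V k
  · rw [toImage_of_mem _ (subset_closureNodes V k h), toImage_of_mem _ h, extend, dif_pos h]
  · rw [toImage_of_notMem u h]
    by_cases h' : i ∈ closureNodes V k
    · rw [toImage_of_mem _ h', extend, dif_neg h]
    · rw [toImage_of_notMem _ h']

theorem prolongation_eq {N : ℕ} (V : Selection N) (hN : 1 ≤ N) (k : ℕ)
    (j : {j // j ∈ closureNodes V (k + 1)}) (i : {i // i ∈ closureNodes V k}) :
    prolongation V k j i = prolongWeight (Node.toLattice j.1 - 2 • Node.toLattice i.1) := by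
  have hn : (N : ℝ) * 2 ^ k ≠ 0 := by positivity
  rw [prolongation, hat_eq_latticeHat, latticeHat, prolongWeight]
  simp only [nodePos, cells, Node.toLattice, two_nsmul, Prod.fst_sub, Prod.snd_sub, Prod.mk_add_mk]
  push_cast
  congr 1 <;> field_simp <;> ring

theorem prolongWeight_neg (a : ℤ × ℤ) : prolongWeight (-a) = prolongWeight a := by
  simp only [prolongWeight, refHat, Prod.fst_neg, Prod.snd_neg]
  push_cast
  rw [neg_div, neg_div, abs_neg, abs_neg, neg_sub_neg, abs_sub_comm]

theorem toImage_prolongation {N : ℕ} (V : Selection N) (hN : 1 ≤ N) (k : ℕ) (v : CVec V k)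
    {j : Node N (k + 1)} (hj : j ∈ closureNodes V (k + 1)) :
    toImage (closureNodes V (k + 1)) (prolongation V k *ᵥ v) j =
      convUp prolongWeight (toImage (closureNodes V k) v) j := by
  rw [toImage_of_mem _ hj, mulVec, dotProduct, convUp, ← sum_mul_toImage]
  refine Finset.sum_congr rfl fun i _ => ?_
  rw [prolongation_eq V hN, ← prolongWeight_neg, neg_sub]

theorem toImage_prolongation_transpose {N : ℕ} (V : Selection N) (hN : 1 ≤ N) (k : ℕ)
    (v : CVec V (k + 1)) {i : Node N k} (hi : i ∈ closureNodes V k) :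
    toImage (closureNodes V k) ((prolongation V k)ᵀ *ᵥ v) i =
      convDown prolongWeight (toImage (closureNodes V (k + 1)) v) i := by
  rw [toImage_of_mem _ hi, mulVec, dotProduct, convDown, ← sum_mul_toImage]
  refine Finset.sum_congr rfl fun j _ => ?_
  rw [transpose_apply, prolongation_eq V hN]

theorem levelMatrix_eq {N : ℕ} (V : Selection N) (κ : ℝ × ℝ → ℝ) (k : ℕ) (i : {i // i ∈ V k})
    (j : {j // j ∈ closureNodes V k}) :
    levelMatrix V κ k i j = ∑ d ∈ window, opCoeff κ N k d (Node.toLattice i.1) *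
      shiftKernel d (Node.toLattice j.1 - Node.toLattice i.1) := by
  have h : levelMatrix V κ k i j =
      opCoeff κ N k (Node.toLattice j.1 - Node.toLattice i.1) (Node.toLattice i.1) := by
    rw [levelMatrix, opCoeff, hat_eq_latticeHat, hat_eq_latticeHat, add_sub_cancel]
  rw [h]
  simp only [shiftKernel, mul_ite, mul_one, mul_zero, Finset.sum_ite_eq]
  split_ifs with hd
  · rfl
  · exact opCoeff_eq_zero _ _ _ _ hd

/-- Sorted by direction, the matrix becomes nine images of entries, each multiplied pointwise with a
shifted copy of the vector. For the transpose the product comes first and the shift, in the opposite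
direction, second. -/
theorem toImage_levelMatrix {N : ℕ} (V : Selection N) (κ : ℝ × ℝ → ℝ) (k : ℕ) (v : CVec V k)
    {i : Node N k} (hi : i ∈ V k) : toImage (V k) (levelMatrix V κ k *ᵥ v) i =
      ∑ d ∈ window, opCoeff κ N k d (Node.toLattice i) *
        conv (shiftKernel d) (toImage (closureNodes V k) v) i := by
  rw [toImage_of_mem _ hi, mulVec, dotProduct]
  simp only [conv, ← sum_mul_toImage, levelMatrix_eq, Finset.sum_mul, Finset.mul_sum]
  rw [Finset.sum_comm]
  simp only [mul_assoc]

theorem toImage_levelMatrix_transpose {N : ℕ} (V : Selection N) (κ : ℝ × ℝ → ℝ) (k : ℕ)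
    (u : VVec V k) {j : Node N k} (hj : j ∈ closureNodes V k) :
    toImage (closureNodes V k) ((levelMatrix V κ k)ᵀ *ᵥ u) j =
      ∑ d ∈ window, conv (shiftKernel (-d))
        (fun i => opCoeff κ N k d (Node.toLattice i) * toImage (V k) u i) j := by
  rw [toImage_of_mem _ hj, mulVec, dotProduct]
  simp only [conv, ← mul_assoc, ← sum_mul_toImage (V k) (fun i => _ * _), levelMatrix_eq,
    transpose_apply, Finset.sum_mul]
  rw [Finset.sum_comm]
  refine Finset.sum_congr rfl fun d _ => Finset.sum_congr rfl fun i _ => ?_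
  rw [mul_comm (opCoeff _ _ _ _ _), shiftKernel_neg, neg_sub]

/-! ### Uniform approximation -/

/-- The filter of uniform convergence on `X` for families that depend on a parameter `δ → 0`. -/
def paramFilter (X : Type*) : Filter (ℝ × X) := 𝓝[≠] (0 : ℝ) ×ˢ ⊤

/-- The functions `g' δ` converge uniformly to the bounded function `g` as `δ → 0`. -/
def Approximates {X : Type*} (g' : ℝ → X → ℝ) (g : X → ℝ) : Prop :=
  (fun q : ℝ × X => g q.2) =O[paramFilter X] (fun _ => (1 : ℝ)) ∧
    (fun q : ℝ × X => g' q.1 q.2 - g q.2) =o[paramFilter X] (fun _ => (1 : ℝ))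

section Approximation

variable {X : Type*}

theorem Approximates.isBigO {g' : ℝ → X → ℝ} {g : X → ℝ} (h : Approximates g' g) :
    (fun q : ℝ × X => g' q.1 q.2) =O[paramFilter X] (fun _ => (1 : ℝ)) := by
  simpa using h.2.isBigO.add h.1

theorem approximates_of_bounded {g : X → ℝ} {B : ℝ} (h : ∀ x, |g x| ≤ B) :
    Approximates (fun _ => g) g :=
  ⟨IsBigO.of_bound B (Eventually.of_forall fun q => by simpa using h q.2), by
    simpa only [sub_self] using
      isLittleO_zero (E' := ℝ) (fun _ : ℝ × X => (1 : ℝ)) (paramFilter X)⟩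

theorem Approximates.const_mul {g' : ℝ → X → ℝ} {g : X → ℝ} (h : Approximates g' g) (c : ℝ) :
    Approximates (fun δ x => c * g' δ x) fun x => c * g x :=
  ⟨h.1.const_mul_left c, by simpa only [mul_sub] using h.2.const_mul_left c⟩

theorem Approximates.add {g' h' : ℝ → X → ℝ} {g h : X → ℝ} (hg : Approximates g' g)
    (hh : Approximates h' h) : Approximates (fun δ x => g' δ x + h' δ x) fun x => g x + h x :=
  ⟨hg.1.add hh.1, by simpa only [add_sub_add_comm] using hg.2.add hh.2⟩

theorem Approximates.sum {ι : Type*} {s : Finset ι} {g' : ι → ℝ → X → ℝ} {g : ι → X → ℝ}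
    (h : ∀ a ∈ s, Approximates (g' a) (g a)) :
    Approximates (fun δ x => ∑ a ∈ s, g' a δ x) fun x => ∑ a ∈ s, g a x :=
  ⟨by simpa only [Finset.sum_fn] using IsBigO.sum fun a ha => (h a ha).1, by
    simpa only [← Finset.sum_sub_distrib, Finset.sum_fn] using
      IsLittleO.sum fun a ha => (h a ha).2⟩

/-! ### Products from second differences of the activation function. -/

/-- The remainder of the second order Taylor expansion of a symmetric second difference. -/
def taylorRemainder (σ : ℝ → ℝ) (x₀ t : ℝ) : ℝ :=
  σ (x₀ + t) + σ (x₀ - t) - 2 * σ x₀ - iteratedDeriv 2 σ x₀ * t ^ 2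

/-- Adding the second order Taylor expansions at `x₀ + t` and `x₀ - t` cancels the linear terms. -/
theorem taylorRemainder_isLittleO {σ : ℝ → ℝ} {x₀ : ℝ} (hσ : ContDiffAt ℝ 3 σ x₀) :
    taylorRemainder σ x₀ =o[𝓝 0] fun t => t ^ 2 := by
  obtain ⟨r, hr, hball⟩ := Metric.eventually_nhds_iff_ball.1 (hσ.eventually (by simp))
  have hmem : x₀ ∈ Metric.ball x₀ r := Metric.mem_ball_self hr
  have hT := taylor_isLittleO (n := 2) (convex_ball x₀ r) hmem
    (fun y hy => ((hball y hy).of_le (by norm_num)).contDiffWithinAt)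
  rw [Metric.isOpen_ball.nhdsWithin_eq hmem] at hT
  have h1 : Tendsto (fun t : ℝ => x₀ + t) (𝓝 0) (𝓝 x₀) :=
    Continuous.tendsto' (by fun_prop) 0 x₀ (add_zero x₀)
  have h2 : Tendsto (fun t : ℝ => x₀ - t) (𝓝 0) (𝓝 x₀) :=
    Continuous.tendsto' (by fun_prop) 0 x₀ (sub_zero x₀)
  have h3 := hT.comp_tendsto h1
  have h4 := hT.comp_tendsto h2
  simp only [Function.comp_def, add_sub_cancel_left, sub_sub_cancel_left, neg_sq] at h3 h4
  refine (h3.add h4).congr_left fun t => ?_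
  have e := iteratedDerivWithin_of_isOpen (n := 2) (f := σ) (Metric.isOpen_ball (x := x₀) (ε := r))
    hmem
  simp only [taylor_within_apply, Finset.sum_range_succ, Finset.sum_range_zero, e,
    taylorRemainder, smul_eq_mul, iteratedDerivWithin_zero, Nat.factorial]
  push_cast
  ring

/-- Polarization: second differences of `σ` yield squares, and `(g + h)² - (g - h)² = 4 g h`. The
factors may themselves be approximations with the same `δ`, which lets products be nested. -/
theorem Approximates.mul {σ : ℝ → ℝ} {x₀ : ℝ} (hσ : ContDiffAt ℝ 3 σ x₀)
    (hne : iteratedDeriv 2 σ x₀ ≠ 0) {g' h' : ℝ → X → ℝ} {g h : X → ℝ}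
    (hg : Approximates g' g) (hh : Approximates h' h) :
    Approximates (fun δ x => (4 * iteratedDeriv 2 σ x₀ * δ ^ 2)⁻¹ *
      (σ (δ * g' δ x + δ * h' δ x + x₀) + σ (-δ * g' δ x + -δ * h' δ x + x₀) -
        σ (δ * g' δ x + -δ * h' δ x + x₀) - σ (-δ * g' δ x + δ * h' δ x + x₀)))
      fun x => g x * h x := by
  have hδ : Tendsto (fun q : ℝ × X => q.1) (paramFilter X) (𝓝 0) :=
    tendsto_fst.mono_right nhdsWithin_le_nhds
  have hδ1 : (fun q : ℝ × X => q.1) =o[paramFilter X] (fun _ => (1 : ℝ)) :=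
    (isLittleO_one_iff ℝ).2 hδ
  -- For uniformly bounded `s` the arguments `δ * s` tend to zero uniformly, so the remainder is
  -- `o(δ²)` uniformly and survives the division by `δ²`.
  have hrem : ∀ s : ℝ × X → ℝ, s =O[paramFilter X] (fun _ => (1 : ℝ)) →
      (fun q : ℝ × X => (q.1 ^ 2)⁻¹ * taylorRemainder σ x₀ (q.1 * s q)) =o[paramFilter X]
        (fun _ => (1 : ℝ)) := by
    intro s hs
    have h0 : Tendsto (fun q : ℝ × X => q.1 * s q) (paramFilter X) (𝓝 0) :=
      (isLittleO_one_iff ℝ).1 (by simpa using hδ1.mul_isBigO hs)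
    have h1 : (fun q : ℝ × X => taylorRemainder σ x₀ (q.1 * s q)) =o[paramFilter X]
        fun q => q.1 ^ 2 := by
      refine ((taylorRemainder_isLittleO hσ).comp_tendsto h0).trans_isBigO ?_
      simpa [Function.comp_def, mul_pow] using
        (isBigO_refl (fun q : ℝ × X => q.1 ^ 2) (paramFilter X)).mul (hs.pow 2)
    rw [isLittleO_one_iff]
    simpa [div_eq_inv_mul] using h1.tendsto_div_nhds_zero
  refine ⟨by simpa using hg.1.mul hh.1, ?_⟩
  have h1 := hrem (fun q => g' q.1 q.2 + h' q.1 q.2) (hg.isBigO.add hh.isBigO)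
  have h2 := hrem (fun q => g' q.1 q.2 - h' q.1 q.2) (hg.isBigO.sub hh.isBigO)
  -- This is `g' h' - g h`, the error inherited from the factors.
  have h3 : (fun q : ℝ × X => (g' q.1 q.2 - g q.2) * h' q.1 q.2 + g q.2 * (h' q.1 q.2 - h q.2))
      =o[paramFilter X] (fun _ => (1 : ℝ)) := by
    simpa using (hg.2.mul_isBigO hh.isBigO).add (hg.1.mul_isLittleO hh.2)
  refine (h3.add ((h1.sub h2).const_mul_left (4 * iteratedDeriv 2 σ x₀)⁻¹)).congr' ?_
    EventuallyEq.rfl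
  have hne0 : ∀ᶠ q : ℝ × X in paramFilter X, q.1 ≠ 0 :=
    tendsto_fst.eventually (eventually_mem_nhdsWithin (a := (0 : ℝ)) (s := {0}ᶜ))
  filter_upwards [hne0] with q hq
  have e1 : q.1 * g' q.1 q.2 + q.1 * h' q.1 q.2 + x₀ =
    x₀ + q.1 * (g' q.1 q.2 + h' q.1 q.2) := by ring
  have e2 : -q.1 * g' q.1 q.2 + -q.1 * h' q.1 q.2 + x₀ =
    x₀ - q.1 * (g' q.1 q.2 + h' q.1 q.2) := by ring
  have e3 : q.1 * g' q.1 q.2 + -q.1 * h' q.1 q.2 + x₀ =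
    x₀ + q.1 * (g' q.1 q.2 - h' q.1 q.2) := by ring
  have e4 : -q.1 * g' q.1 q.2 + q.1 * h' q.1 q.2 + x₀ =
    x₀ - q.1 * (g' q.1 q.2 - h' q.1 q.2) := by ring
  rw [e1, e2, e3, e4, taylorRemainder, taylorRemainder]
  field_simp
  ring

end Approximation

/-! ### Units with a window of three by three pixels -/

/-- Whether a mask keeps a pixel. -/
def MaskKind.Keeps {N : ℕ} (V : Selection N) {k : ℕ} (i : Node N k) : MaskKind → Prop
  | .none => True
  | .selected => i ∈ V k
  | .closure => i ∈ closureNodes V k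

open Classical in
/-- Multiplication with a mask. -/
def applyMask {N : ℕ} (V : Selection N) {k : ℕ} (mask : MaskKind) (g : Image N k) : Image N k :=
  fun i => if mask.Keeps V i then g i else 0

theorem applyMask_none {N : ℕ} (V : Selection N) {k : ℕ} (g : Image N k) :
    applyMask V .none g = g := by
  funext i
  simp [applyMask, MaskKind.Keeps]

/-- A unit that reads the channels `c a`, for `a ∈ s`, with the kernels `K a`. -/
def stencilUnit {L : ℕ} {ι : Type*} (k : Fin L) (t : ℕ) (kind : ConvKind) (s : Finset ι)
    (c : ι → ℕ) (K : ι → ℤ × ℤ → ℝ) (b : ℝ) (act : Bool) (mask : MaskKind) : ConvUnit L where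
  level := k
  target := t
  kind := kind
  sources := s.image c
  radius := 1
  kernel ch p := ∑ a ∈ s with c a = ch, K a p
  bias := b
  useActivation := act
  mask := mask

section Units

variable {L N : ℕ} {ι : Type*} {σ : ℝ → ℝ} {V : Selection N}

theorem stencilUnit_numWeights_le (k : Fin L) (t : ℕ) (kind : ConvKind) (s : Finset ι)
    (c : ι → ℕ) (K : ι → ℤ × ℤ → ℝ) (b : ℝ) (act : Bool) (mask : MaskKind) :
    (stencilUnit k t kind s c K b act mask).numWeights ≤ 9 * s.card + 1 := by
  have := Finset.card_image_le (s := s) (f := c)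
  simp only [ConvUnit.numWeights, stencilUnit]
  omega

/-- The channel map `c` need not be injective, since channels come from existence statements.
Kernels that meet in the same channel are added, which is correct by linearity and never increases
the number of weights. -/
theorem stencilUnit_sum {κ : Type*} [Fintype κ] (k : Fin L) (t : ℕ) (kind : ConvKind)
    {s : Finset ι} (c : ι → ℕ) {K : ι → ℤ × ℤ → ℝ} (hK : ∀ a ∈ s, ∀ p ∉ window, K a p = 0)
    (b : ℝ) (act : Bool) (mask : MaskKind) (p : κ → ℤ × ℤ) (y : ℕ → κ → ℝ) :
    ∑ ch ∈ s.image c, ∑ j, (stencilUnit k t kind s c K b act mask).entry ch (p j).1 (p j).2 *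
      y ch j = ∑ a ∈ s, ∑ j, K a (p j) * y (c a) j := by
  have hentry : ∀ ch q, (stencilUnit k t kind s c K b act mask).entry ch q.1 q.2 =
      ∑ a ∈ s with c a = ch, K a q := by
    intro ch q
    simp only [ConvUnit.entry, stencilUnit, Nat.cast_one]
    split_ifs with h
    · rfl
    · exact (Finset.sum_eq_zero fun a ha =>
        hK a (Finset.mem_filter.1 ha).1 q (mt mem_window.1 h)).symm
  simp only [hentry]
  rw [← Finset.sum_fiberwise_of_maps_to (fun a ha => Finset.mem_image_of_mem c ha)]
  refine Finset.sum_congr rfl fun ch _ => ?_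
  rw [Finset.sum_comm]
  refine Finset.sum_congr rfl fun j _ => ?_
  rw [Finset.sum_mul]
  refine Finset.sum_congr rfl fun a ha => ?_
  rw [(Finset.mem_filter.1 ha).2]

/-- The activation function or the identity. -/
def activate (σ : ℝ → ℝ) (act : Bool) (z : ℝ) : ℝ := if act then σ z else z

theorem vanillaUnit_output {k : ℕ} (hk : k < L) (t : ℕ) {s : Finset ι} (c : ι → ℕ)
    {K : ι → ℤ × ℤ → ℝ} (hK : ∀ a ∈ s, ∀ p ∉ window, K a p = 0) (b : ℝ) (act : Bool)
    (mask : MaskKind) (x : Features N) :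
    (stencilUnit ⟨k, hk⟩ t .vanilla s c K b act mask).output σ V x =
      applyMask V mask fun i =>
        activate σ act (∑ a ∈ s, conv (K a) (x k (c a)) i + b) := by
  refine funext fun (i : Node N k) => ?_
  have h := stencilUnit_sum ⟨k, hk⟩ t .vanilla c hK b act mask
    (fun j : Node N k => ((j.1.val : ℤ) - i.1.val, (j.2.val : ℤ) - i.2.val)) (x k)
  have hiff : (stencilUnit (⟨k, hk⟩ : Fin L) t .vanilla s c K b act mask).Keeps V x i ↔
      mask.Keeps V i := by
    cases mask <;> exact ⟨fun h => h.2, fun h => ⟨trivial, h⟩⟩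
  by_cases hm : mask.Keeps V i
  · refine (if_pos (hiff.2 hm)).trans (Eq.trans ?_ (if_pos hm).symm)
    exact (congrArg (fun z => activate σ act (z + b)) h).trans (by
      simp [conv, Node.toLattice])
  · exact (if_neg (mt hiff.1 hm)).trans (if_neg hm).symm

theorem stridedUnit_output {k : ℕ} (hk : k < L) (t : ℕ) {s : Finset ι} (c : ι → ℕ)
    {K : ι → ℤ × ℤ → ℝ} (hK : ∀ a ∈ s, ∀ p ∉ window, K a p = 0) (b : ℝ) (act : Bool)
    (mask : MaskKind) (x : Features N) :
    (stencilUnit ⟨k, hk⟩ t .strided s c K b act mask).output σ V x =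
      applyMask V mask fun i =>
        activate σ act (∑ a ∈ s, convDown (K a) (x (k + 1) (c a)) i + b) := by
  refine funext fun (i : Node N k) => ?_
  have h := stencilUnit_sum ⟨k, hk⟩ t .strided c hK b act mask
    (fun j : Node N (k + 1) => ((j.1.val : ℤ) - 2 * i.1.val, (j.2.val : ℤ) - 2 * i.2.val)) (x (k + 1))
  have hiff : (stencilUnit (⟨k, hk⟩ : Fin L) t .strided s c K b act mask).Keeps V x i ↔
      mask.Keeps V i := by
    cases mask <;> exact ⟨fun h => h.2, fun h => ⟨trivial, h⟩⟩
  by_cases hm : mask.Keeps V i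
  · refine (if_pos (hiff.2 hm)).trans (Eq.trans ?_ (if_pos hm).symm)
    exact (congrArg (fun z => activate σ act (z + b)) h).trans (by
      simp [convDown, Node.toLattice])
  · exact (if_neg (mt hiff.1 hm)).trans (if_neg hm).symm

theorem transposedUnit_output {k : ℕ} (hk : k + 1 < L) (t : ℕ) {s : Finset ι} (c : ι → ℕ)
    {K : ι → ℤ × ℤ → ℝ} (hK : ∀ a ∈ s, ∀ p ∉ window, K a p = 0) (b : ℝ) (act : Bool)
    (mask : MaskKind) (x : Features N) :
    (stencilUnit ⟨k + 1, hk⟩ t .transposed s c K b act mask).output σ V x =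
      applyMask V mask fun i =>
        activate σ act (∑ a ∈ s, convUp (K a) (x k (c a)) i + b) := by
  refine funext fun (i : Node N (k + 1)) => ?_
  have h := stencilUnit_sum ⟨k + 1, hk⟩ t .transposed c hK b act mask
    (fun j : Node N k => (2 * (j.1.val : ℤ) - i.1.val, 2 * (j.2.val : ℤ) - i.2.val)) (x k)
  have hiff : (stencilUnit (⟨k + 1, hk⟩ : Fin L) t .transposed s c K b act mask).Keeps V x i ↔
      mask.Keeps V i := by
    cases mask <;> exact ⟨fun h => h.2, fun h => ⟨trivial, h⟩⟩
  by_cases hm : mask.Keeps V i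
  · refine (if_pos (hiff.2 hm)).trans (Eq.trans ?_ (if_pos hm).symm)
    exact (congrArg (fun z => activate σ act (z + b)) h).trans (by
      simp [convUp, Node.toLattice])
  · exact (if_neg (mt hiff.1 hm)).trans (if_neg hm).symm

theorem apply_of_ne {x : Features N} {U : ConvUnit L} {k c : ℕ} (h : c ≠ U.target) :
    U.apply σ V x k c = x k c := by
  rw [ConvUnit.apply]
  by_cases hk : k = U.level
  · subst hk
    rw [Function.update_self, Function.update_of_ne h]
  · rw [Function.update_of_ne hk]

theorem apply_self (x : Features N) (U : ConvUnit L) :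
    U.apply σ V x U.level U.target = U.output σ V x := by
  rw [ConvUnit.apply, Function.update_self, Function.update_self]

end Units

/-! ### Realizability of families of images -/

/-- A family of images of level `k`, indexed by the inputs in `X`. -/
abbrev ImageFamily (N : ℕ) (X : Type*) : Type _ := (k : ℕ) × (X → Image N k)

/-- Channel `c` of level `k` converges uniformly to the family `g`. -/
def Represents {N : ℕ} {X : Type*} (feat : ℝ → X → Features N) (k c : ℕ) (g : X → Image N k) :
    Prop :=
  ∀ i, Approximates (fun δ x => feat δ x k c i) fun x => g x i

/-- The images that are present after the evaluation of some units. -/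
def run {L N : ℕ} (σ : ℝ → ℝ) (V : Selection N) (us : List (ConvUnit L)) (x : Features N) :
    Features N :=
  us.foldl (ConvUnit.apply σ V) x

/-- The families in `A` are approximated, on input `init x`, by networks with at most `W`
weights. -/
def Realizable {N : ℕ} {X : Type*} (L : ℕ) (σ : ℝ → ℝ) (V : Selection N)
    (init : X → Features N) (W : ℕ) (A : Set (ImageFamily N X)) : Prop :=
  ∃ us : ℝ → List (ConvUnit L), (∀ δ, ((us δ).map ConvUnit.numWeights).sum ≤ W) ∧
    ∃ B, ∀ p ∈ A, ∃ c < B, Represents (fun δ x => run σ V (us δ) (init x)) p.1 c p.2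

/-- The families in `B` can be computed from those in `A` by units with at most `c` weights. -/
def Computes {N : ℕ} {X : Type*} (L : ℕ) (σ : ℝ → ℝ) (V : Selection N)
    (init : X → Features N) (c : ℕ) (A B : Set (ImageFamily N X)) : Prop :=
  ∀ W A', A ⊆ A' → Realizable L σ V init W A' → Realizable L σ V init (W + c) (A' ∪ B)

section Rules

variable {L N : ℕ} {X : Type*} {σ : ℝ → ℝ} {V : Selection N} {init : X → Features N}
  {A B C : Set (ImageFamily N X)} {c c' : ℕ}

theorem Realizable.mono {W W' : ℕ} (h : Realizable L σ V init W A) (hW : W ≤ W') (hBA : B ⊆ A) :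
    Realizable L σ V init W' B := by
  obtain ⟨us, hus, b, hb⟩ := h
  exact ⟨us, fun δ => (hus δ).trans hW, b, fun p hp => hb p (hBA hp)⟩

theorem Computes.mono (h : Computes L σ V init c A B) (hc : c ≤ c') {A₁ B₁ : Set (ImageFamily N X)}
    (hA : A ⊆ A₁) (hB : B₁ ⊆ A₁ ∪ B) : Computes L σ V init c' A₁ B₁ := fun W A' hA' hR =>
  (h W A' (hA.trans hA') hR).mono (by omega) (Set.union_subset Set.subset_union_left
    (hB.trans (Set.union_subset_union_left _ hA')))

theorem Computes.of_subset (h : B ⊆ A) : Computes L σ V init c A B := fun _ _ hA' hR =>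
  hR.mono (by omega) (Set.union_subset le_rfl (h.trans hA'))

/-- Composition: everything computed so far remains available. -/
theorem Computes.trans_union (h₁ : Computes L σ V init c A B)
    (h₂ : Computes L σ V init c' (A ∪ B) C) : Computes L σ V init (c + c') A (B ∪ C) :=
  fun W A' hA' hR => by
    have := h₂ _ _ (Set.union_subset_union_left B hA') (h₁ W A' hA' hR)
    rwa [Set.union_assoc, add_assoc] at this

theorem Computes.trans (h₁ : Computes L σ V init c A B) (h₂ : Computes L σ V init c' (A ∪ B) C) :
    Computes L σ V init (c + c') A C :=
  (h₁.trans_union h₂).mono le_rfl le_rfl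
    (Set.subset_union_right.trans Set.subset_union_right)

theorem Computes.union (h₁ : Computes L σ V init c A B) (h₂ : Computes L σ V init c' A C) :
    Computes L σ V init (c + c') A (B ∪ C) :=
  h₁.trans_union (h₂.mono le_rfl Set.subset_union_left Set.subset_union_right)

/-- The families are computed one after another from the same inputs, so the costs add up. In the
applications the index set is usually the nine directions. -/
theorem Computes.biUnion {ι : Type*} (s : Finset ι) {F : ι → ImageFamily N X}
    (h : ∀ a ∈ s, Computes L σ V init c A {F a}) :
    Computes L σ V init (c * s.card) A (F '' s) := by
  classical
  induction s using Finset.induction_on with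
  | empty => exact Computes.of_subset (by simp)
  | insert a s ha ih =>
    refine ((h a (Finset.mem_insert_self a s)).union
      (ih fun b hb => h b (Finset.mem_insert_of_mem hb))).mono ?_ le_rfl ?_
    · rw [Finset.card_insert_of_notMem ha, mul_add, mul_one, add_comm]
    · rw [Finset.coe_insert, Set.image_insert_eq]
      exact Set.subset_union_right

/-- One more unit, whose output approximates a new family. -/
theorem computes_of_unit {k : ℕ} {g : X → Image N k}
    (h : ∀ (feat : ℝ → X → Features N) (b : ℕ),
      (∀ p ∈ A, ∃ c < b, Represents feat p.1 c p.2) →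
      ∃ us : ℝ → List (ConvUnit L), (∀ δ, ((us δ).map ConvUnit.numWeights).sum ≤ c) ∧
        (∀ δ, ∀ U ∈ us δ, b ≤ U.target) ∧
        ∃ t, Represents (fun δ x => run σ V (us δ) (feat δ x)) k t g) :
    Computes L σ V init c A {⟨k, g⟩} := by
  rintro W A' hA ⟨us, hus, b, hb⟩
  obtain ⟨us', hus', ht, t, hg⟩ := h _ b fun p hp => hb p (hA hp)
  -- New units write only to channels from `b` on, so all images found so far survive.
  have hrun : ∀ us₂ : List (ConvUnit L), (∀ U ∈ us₂, b ≤ U.target) → ∀ (x : Features N) (k c : ℕ),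
      c < b → run σ V us₂ x k c = x k c := by
    intro us₂
    induction us₂ with
    | nil => exact fun _ _ _ _ _ => rfl
    | cons U us₂ ih =>
      intro hU x k c hc
      rw [run, List.foldl_cons, ← run, ih (fun U' hU' => hU U' (List.mem_cons_of_mem _ hU')) _ _ _ hc,
        apply_of_ne (hc.trans_le (hU U List.mem_cons_self)).ne]
  refine ⟨fun δ => us δ ++ us' δ, fun δ => ?_, max b (t + 1), ?_⟩
  · rw [List.map_append, List.sum_append]
    exact add_le_add (hus δ) (hus' δ)
  · have happ : ∀ δ x, run σ V (us δ ++ us' δ) (init x) =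
        run σ V (us' δ) (run σ V (us δ) (init x)) := fun δ x => List.foldl_append
    simp only [happ]
    rintro p (hp | rfl)
    · obtain ⟨c, hc, hp⟩ := hb p hp
      refine ⟨c, lt_max_of_lt_left hc, fun i => ?_⟩
      simp only [hrun _ (ht _) _ _ _ hc]
      exact hp i
    · exact ⟨t, lt_max_of_lt_right (Nat.lt_succ_self t), hg⟩

/-! ### Linear stencils as rules of the calculus. -/

theorem Approximates.applyMask_eval {k : ℕ} {g' : ℝ → X → Image N k} {g : X → Image N k}
    (mask : MaskKind) (i : Node N k)
    (h : Approximates (fun δ x => g' δ x i) fun x => g x i) :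
    Approximates (fun δ x => applyMask V mask (g' δ x) i) fun x => applyMask V mask (g x) i := by
  by_cases hm : mask.Keeps V i
  · simpa only [applyMask, if_pos hm] using h
  · simp only [applyMask, if_neg hm]
    exact approximates_of_bounded (B := 0) (by simp)

/-- Common to the vanilla, strided and transposed cases: such a unit is a fixed linear map
independent of `δ`, and finite linear combinations preserve uniform convergence. -/
theorem computes_of_linear_unit {ι : Type*} {k ks : ℕ} (hk : k < L) {s : Finset ι}
    {K : ι → ℤ × ℤ → ℝ} {g : ι → X → Image N ks} (hg : ∀ a ∈ s, ⟨ks, g a⟩ ∈ A) (kind : ConvKind)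
    (mask : MaskKind) (T : (ℤ × ℤ → ℝ) → Image N ks → Image N k)
    (pos : Node N k → Node N ks → ℤ × ℤ)
    (hT : ∀ K g i, T K g i = ∑ j, K (pos i j) * g j)
    (hout : ∀ (t : ℕ) (c : ι → ℕ) (x : Features N),
      (stencilUnit ⟨k, hk⟩ t kind s c K 0 false mask).output σ V x =
        applyMask V mask fun i => activate σ false (∑ a ∈ s, T (K a) (x ks (c a)) i + 0)) :
    Computes L σ V init (9 * s.card + 1) A
      {⟨k, fun x => applyMask V mask fun i => ∑ a ∈ s, T (K a) (g a x) i⟩} := by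
  refine computes_of_unit fun feat b hA => ?_
  -- For indices outside `s` the channel is irrelevant and set to `0`.
  have hc : ∀ a, ∃ c, a ∈ s → c < b ∧ Represents feat ks c (g a) := fun a => by
    by_cases ha : a ∈ s
    · obtain ⟨c, hc⟩ := hA _ (hg a ha)
      exact ⟨c, fun _ => hc⟩
    · exact ⟨0, fun h => absurd h ha⟩
  choose c hc using hc
  refine ⟨fun _ => [stencilUnit ⟨k, hk⟩ b kind s c K 0 false mask], fun δ => ?_, fun δ U hU => ?_,
    b, fun i => ?_⟩
  · simpa using stencilUnit_numWeights_le ⟨k, hk⟩ b kind s c K 0 false mask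
  · rw [List.mem_singleton.1 hU, stencilUnit]
  · have h : ∀ δ x, run σ V [stencilUnit ⟨k, hk⟩ b kind s c K 0 false mask] (feat δ x) k b i =
        applyMask V mask (fun i => ∑ a ∈ s, T (K a) (feat δ x ks (c a)) i) i := by
      intro δ x
      refine (congrFun (apply_self (σ := σ) (V := V) (feat δ x)
        (stencilUnit ⟨k, hk⟩ b kind s c K 0 false mask)) i).trans ?_
      rw [hout]
      simp [activate]
    simp only [h]
    refine Approximates.applyMask_eval mask i (Approximates.sum fun a ha => ?_)
    simp only [hT]
    exact Approximates.sum fun j _ => ((hc a ha).2 j).const_mul _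

theorem computes_conv {ι : Type*} {k : ℕ} (hk : k < L) {s : Finset ι} {K : ι → ℤ × ℤ → ℝ}
    (hK : ∀ a ∈ s, ∀ p ∉ window, K a p = 0) {g : ι → X → Image N k}
    (hg : ∀ a ∈ s, ⟨k, g a⟩ ∈ A) (mask : MaskKind) :
    Computes L σ V init (9 * s.card + 1) A
      {⟨k, fun x => applyMask V mask fun i => ∑ a ∈ s, conv (K a) (g a x) i⟩} :=
  computes_of_linear_unit hk hg .vanilla mask conv _ (fun _ _ _ => rfl)
    fun t c x => vanillaUnit_output hk t c hK 0 false mask x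

theorem computes_convDown {ι : Type*} {k : ℕ} (hk : k < L) {s : Finset ι} {K : ι → ℤ × ℤ → ℝ}
    (hK : ∀ a ∈ s, ∀ p ∉ window, K a p = 0) {g : ι → X → Image N (k + 1)}
    (hg : ∀ a ∈ s, ⟨k + 1, g a⟩ ∈ A) (mask : MaskKind) :
    Computes L σ V init (9 * s.card + 1) A
      {⟨k, fun x => applyMask V mask fun i => ∑ a ∈ s, convDown (K a) (g a x) i⟩} :=
  computes_of_linear_unit hk hg .strided mask convDown _ (fun _ _ _ => rfl)
    fun t c x => stridedUnit_output hk t c hK 0 false mask x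

theorem computes_convUp {ι : Type*} {k : ℕ} (hk : k + 1 < L) {s : Finset ι} {K : ι → ℤ × ℤ → ℝ}
    (hK : ∀ a ∈ s, ∀ p ∉ window, K a p = 0) {g : ι → X → Image N k}
    (hg : ∀ a ∈ s, ⟨k, g a⟩ ∈ A) (mask : MaskKind) :
    Computes L σ V init (9 * s.card + 1) A
      {⟨k + 1, fun x => applyMask V mask fun i => ∑ a ∈ s, convUp (K a) (g a x) i⟩} :=
  computes_of_linear_unit hk hg .transposed mask convUp _ (fun _ _ _ => rfl)
    fun t c x => transposedUnit_output hk t c hK 0 false mask x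

theorem zero_mem_window : (0 : ℤ × ℤ) ∈ window := by
  simp [mem_window]

theorem conv_smul_shiftKernel_zero {k : ℕ} (r : ℝ) (g : Image N k) (i : Node N k) :
    conv (fun a => r * shiftKernel 0 a) g i = r * g i := by
  conv_rhs => rw [← conv_shiftKernel_zero g]
  simp [conv, Finset.mul_sum, mul_assoc]

/-- Pointwise combinations of images. -/
theorem computes_combination {ι : Type*} {k : ℕ} (hk : k < L) {s : Finset ι} (r : ι → ℝ)
    {g : ι → X → Image N k} (hg : ∀ a ∈ s, ⟨k, g a⟩ ∈ A) (mask : MaskKind) :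
    Computes L σ V init (9 * s.card + 1) A
      {⟨k, fun x => applyMask V mask fun i => ∑ a ∈ s, r a * g a x i⟩} := by
  have := computes_conv (σ := σ) (V := V) (init := init) hk (s := s)
    (K := fun a p => r a * shiftKernel 0 p)
    (fun a _ p hp => by rw [shiftKernel_eq_zero zero_mem_window hp, mul_zero]) hg mask
  simpa only [conv_smul_shiftKernel_zero] using this

/-! ### Pointwise products as rules of the calculus. -/

/-- A unit that acts on each pixel separately. -/
def pointUnit {ι : Type*} [Fintype ι] (k : Fin L) (t : ℕ) (c : ι → ℕ) (r : ι → ℝ) (b : ℝ)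
    (act : Bool) : ConvUnit L :=
  stencilUnit k t .vanilla Finset.univ c (fun a p => r a * shiftKernel 0 p) b act .none

theorem pointUnit_numWeights_le {ι : Type*} [Fintype ι] (k : Fin L) (t : ℕ) (c : ι → ℕ)
    (r : ι → ℝ) (b : ℝ) (act : Bool) :
    (pointUnit k t c r b act).numWeights ≤ 9 * Fintype.card ι + 1 :=
  stencilUnit_numWeights_le _ _ _ _ _ _ _ _ _

theorem apply_pointUnit_self {ι : Type*} [Fintype ι] {k : ℕ} (hk : k < L) (t : ℕ) (c : ι → ℕ)
    (r : ι → ℝ) (b : ℝ) (act : Bool) (x : Features N) (i : Node N k) :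
    (pointUnit ⟨k, hk⟩ t c r b act).apply σ V x k t i =
      activate σ act (∑ a, r a * x k (c a) i + b) := by
  refine (congrFun (apply_self (σ := σ) (V := V) x (pointUnit ⟨k, hk⟩ t c r b act)) i).trans
    ((congrFun (vanillaUnit_output hk t c (fun a _ p hp => by
      rw [shiftKernel_eq_zero zero_mem_window hp, mul_zero]) b act .none x) i).trans ?_)
  rw [applyMask_none]
  simp only [conv_smul_shiftKernel_zero]

theorem apply_pointUnit_of_ne {ι : Type*} [Fintype ι] {k : Fin L} {t : ℕ} {c : ι → ℕ}
    {r : ι → ℝ} {b : ℝ} {act : Bool} {x : Features N} {k' ch : ℕ} (h : ch ≠ t) :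
    (pointUnit k t c r b act).apply σ V x k' ch = x k' ch :=
  apply_of_ne h

/-- The units that approximate a product. -/
def productUnits (k : Fin L) (b : ℕ) (c : Fin 2 → ℕ) (x₀ e δ : ℝ) : List (ConvUnit L) :=
  [pointUnit k b c ![δ, δ] x₀ true, pointUnit k (b + 1) c ![-δ, -δ] x₀ true,
    pointUnit k (b + 2) c ![δ, -δ] x₀ true, pointUnit k (b + 3) c ![-δ, δ] x₀ true,
    pointUnit k (b + 4) ![b, b + 1, b + 2, b + 3] ![e, e, -e, -e] 0 false]

theorem run_productUnits {k : ℕ} (hk : k < L) (b : ℕ) {c : Fin 2 → ℕ} (hc : ∀ a, c a < b)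
    (x₀ e δ : ℝ) (x : Features N) (i : Node N k) :
    run σ V (productUnits ⟨k, hk⟩ b c x₀ e δ) x k (b + 4) i =
      e * (σ (δ * x k (c 0) i + δ * x k (c 1) i + x₀) +
        σ (-δ * x k (c 0) i + -δ * x k (c 1) i + x₀) -
        σ (δ * x k (c 0) i + -δ * x k (c 1) i + x₀) -
        σ (-δ * x k (c 0) i + δ * x k (c 1) i + x₀)) := by
  have hc0 : ∀ a, c a ≠ b := fun a => (hc a).ne
  have hct : ∀ a t, c a ≠ b + t := fun a t => by have := hc a; omega
  rw [run, productUnits]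
  simp only [List.foldl_cons, List.foldl_nil]
  rw [apply_pointUnit_self]
  simp only [Fin.sum_univ_four, Matrix.cons_val]
  simp (disch := first | exact hct _ _ | exact hc0 _ | simp) only
    [apply_pointUnit_self, apply_pointUnit_of_ne, Fin.sum_univ_two, Matrix.cons_val]
  simp only [activate, if_true, Bool.false_eq_true, if_false]
  ring

/-- Pointwise products of images. -/
theorem computes_mul (hσ : IsAdmissibleActivation σ) {k : ℕ} (hk : k < L) {g h : X → Image N k}
    (hg : ⟨k, g⟩ ∈ A) (hh : ⟨k, h⟩ ∈ A) :
    Computes L σ V init 113 A {⟨k, fun x i => g x i * h x i⟩} := by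
  obtain ⟨-, x₀, hσ, hne⟩ := hσ
  refine computes_of_unit fun feat b hA => ?_
  obtain ⟨c₁, hc₁, hg⟩ := hA _ hg
  obtain ⟨c₂, hc₂, hh⟩ := hA _ hh
  -- The output weight is the normalization from `Approximates.mul`; the same `δ` enters the four
  -- activated units.
  refine ⟨fun δ => productUnits ⟨k, hk⟩ b ![c₁, c₂] x₀ (4 * iteratedDeriv 2 σ x₀ * δ ^ 2)⁻¹ δ,
    fun δ => ?_, fun δ U hU => ?_, b + 4, fun i => ?_⟩
  -- Four units with at most two sources and one with at most four: `4 * 19 + 37 = 113`.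
  · simp only [productUnits, List.map_cons, List.map_nil, List.sum_cons, List.sum_nil]
    refine (Nat.add_le_add (pointUnit_numWeights_le _ _ _ _ _ _) <|
      Nat.add_le_add (pointUnit_numWeights_le _ _ _ _ _ _) <|
      Nat.add_le_add (pointUnit_numWeights_le _ _ _ _ _ _) <|
      Nat.add_le_add (pointUnit_numWeights_le _ _ _ _ _ _) <|
      Nat.add_le_add (pointUnit_numWeights_le _ _ _ _ _ _) le_rfl).trans ?_
    simp
  · simp only [productUnits, List.mem_cons, List.not_mem_nil, or_false] at hU
    rcases hU with rfl | rfl | rfl | rfl | rfl <;> simp [pointUnit, stencilUnit]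
  · have hc : ∀ a, ![c₁, c₂] a < b := fun a => by fin_cases a <;> assumption
    simp only [run_productUnits hk b hc]
    exact Approximates.mul hσ hne (hg i) (hh i)

end Rules

/-! ### The operator and the load vector on all levels -/

/-- At an interior coarse node the stencil reads interior fine nodes only. Hence wrong entries at
boundary nodes never reach the interior when data are passed to coarser levels. -/
theorem convDown_congr {N k : ℕ} {K : ℤ × ℤ → ℝ} (hK : ∀ a ∉ window, K a = 0)
    {g g' : Image N (k + 1)} (h : ∀ j, IsInterior j → g j = g' j) {i : Node N k}
    (hi : IsInterior i) : convDown K g i = convDown K g' i := by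
  refine Finset.sum_congr rfl fun j _ => ?_
  by_cases hj : Node.toLattice j - 2 • Node.toLattice i ∈ window
  · rw [h j (isInterior_of_sub_mem_window hi hj)]
  · rw [hK _ hj, zero_mul, zero_mul]

/-- The families `Q` and `F` hold, at interior nodes, the operator and the load vector of a
level. -/
structure IsLevelData {N : ℕ} {X : Type*} (κ f : X → ℝ × ℝ → ℝ) (k : ℕ)
    (Q : ℤ × ℤ → X → Image N k) (F : X → Image N k) : Prop where
  op : ∀ d ∈ window, ∀ x i, IsInterior i → Q d x i = opCoeff (κ x) N k d (Node.toLattice i)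
  load : ∀ x i, IsInterior i → F x i = loadCoeff (f x) N k (Node.toLattice i)

/-- The set of families that consists of the operator and the load vector of a level. -/
def levelSet {N : ℕ} {X : Type*} (k : ℕ) (Q : ℤ × ℤ → X → Image N k) (F : X → Image N k) :
    Set (ImageFamily N X) :=
  (fun d => (⟨k, Q d⟩ : ImageFamily N X)) '' window ∪ {⟨k, F⟩}

section Data

variable {L N : ℕ} {X : Type*} {σ : ℝ → ℝ} {V : Selection N} {init : X → Features N}

theorem exists_levelData_finest {K : ℕ} (hK : K < L) (κ f : X → Image N K) :
    ∃ Q F, IsLevelData (fun x => feFun N K (κ x)) (fun x => feFun N K (f x)) K Q F ∧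
      Computes L σ V init 748 {⟨K, κ⟩, ⟨K, f⟩} (levelSet K Q F) := by
  refine ⟨fun d x => applyMask V .none fun i => ∑ _a ∈ ({0} : Finset ℕ),
      conv (tripleWeight (cells N K) d) (κ x) i,
    fun x => applyMask V .none fun i => ∑ _a ∈ ({0} : Finset ℕ),
      conv (massWeight (cells N K)) (f x) i, ⟨fun d _ x i hi => ?_, fun x i hi => ?_⟩, ?_⟩
  · rw [applyMask_none, Finset.sum_singleton, opCoeff_finest _ _ hi]
  · rw [applyMask_none, Finset.sum_singleton, loadCoeff_finest _ hi]
  -- Ten kernels with one source each cost only 100; the bound is relaxed to that of the coarser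
  -- levels.
  · refine ((Computes.biUnion window fun d _ => ?_).union (c' := 10) ?_).mono (c := 10 * 9 + 10)
      (by norm_num) le_rfl Set.subset_union_right
    · exact computes_conv hK (s := {0}) (K := fun _ => tripleWeight (cells N K) d)
        (fun _ _ p hp => tripleWeight_eq_zero hp) (g := fun _ => κ) (by simp) .none
    · exact computes_conv hK (s := {0}) (K := fun _ => massWeight (cells N K))
        (fun _ _ p hp => massWeight_eq_zero hp) (g := fun _ => f) (by simp) .none

theorem exists_levelData_coarser {κ f : X → ℝ × ℝ → ℝ} (hκ : ∀ x, Continuous (κ x))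
    (hf : ∀ x, Continuous (f x)) {k : ℕ} (hk : k < L) {Q : ℤ × ℤ → X → Image N (k + 1)}
    {F : X → Image N (k + 1)} (h : IsLevelData κ f (k + 1) Q F) :
    ∃ Q' F', IsLevelData κ f k Q' F' ∧
      Computes L σ V init 748 (levelSet (k + 1) Q F) (levelSet k Q' F') := by
  refine ⟨fun d x => applyMask V .none fun i => ∑ d' ∈ window,
      convDown (coarsenWeight d d') (Q d' x) i,
    fun x => applyMask V .none fun i => ∑ _a ∈ ({0} : Finset ℕ),
      convDown prolongWeight (F x) i, ⟨fun d _ x i hi => ?_, fun x i hi => ?_⟩, ?_⟩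
  · rw [applyMask_none, opCoeff_coarsen (hκ x) hi]
    exact Finset.sum_congr rfl fun d' hd' =>
      convDown_congr (fun a => coarsenWeight_eq_zero d d') (h.op d' hd' x) hi
  · rw [applyMask_none, Finset.sum_singleton, loadCoeff_coarsen (hf x) hi]
    exact convDown_congr (fun a => prolongWeight_eq_zero) (h.load x) hi
  -- Each of the nine coarse entry images reads all nine fine ones, at cost `9 * 9 + 1 = 82`; the
  -- load adds 10.
  · refine ((Computes.biUnion window fun d _ => ?_).union (c' := 10) ?_).mono (c := 82 * 9 + 10)
      (by norm_num) le_rfl Set.subset_union_right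
    · exact computes_convDown hk (s := window) (K := coarsenWeight d)
        (fun d' _ p hp => coarsenWeight_eq_zero d d' hp)
        (fun d' hd' => Or.inl ⟨d', hd', rfl⟩) .none
    · exact computes_convDown hk (s := {0}) (K := fun _ => prolongWeight)
        (fun _ _ p hp => prolongWeight_eq_zero hp) (g := fun _ => F)
        (fun _ _ => Or.inr rfl) .none

/-- The induction descends from the finest level, `n` being the number of levels below it already
reached. `D` collects the data of all of them, because the sweeps need every level. -/
theorem exists_levelData_of_le (hL : 1 ≤ L) (κ f : X → Image N (L - 1)) (n : ℕ) (hn : n < L) :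
    ∃ D : Set (ImageFamily N X),
      Computes L σ V init (748 * (n + 1)) {⟨L - 1, κ⟩, ⟨L - 1, f⟩} D ∧
      ∀ k < L, L - 1 - n ≤ k → ∃ Q F, IsLevelData (fun x => feFun N (L - 1) (κ x))
        (fun x => feFun N (L - 1) (f x)) k Q F ∧ levelSet k Q F ⊆ D := by
  induction n with
  | zero =>
    obtain ⟨Q, F, hQF, hc⟩ := exists_levelData_finest (σ := σ) (V := V) (init := init)
      (by omega : L - 1 < L) κ f
    refine ⟨levelSet _ Q F, hc, fun k hk hk' => ?_⟩
    obtain rfl : k = L - 1 := by omega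
    exact ⟨Q, F, hQF, le_rfl⟩
  | succ n ih =>
    obtain ⟨D, hD, hlev⟩ := ih (by omega)
    obtain ⟨k, hk⟩ : ∃ k, L - 1 - n = k + 1 := ⟨L - 1 - n - 1, by omega⟩
    obtain ⟨Q, F, hQF, hsub⟩ := hlev (k + 1) (by omega) hk.le
    obtain ⟨Q', F', hQF', hc⟩ := exists_levelData_coarser (σ := σ) (V := V) (init := init)
      (fun x => continuous_feFun _ _ _) (fun x => continuous_feFun _ _ _)
      (by omega : k < L) hQF
    refine ⟨D ∪ levelSet k Q' F', ?_, fun k' hk' hle => ?_⟩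
    · have h2 : Computes L σ V init 748 ({⟨L - 1, κ⟩, ⟨L - 1, f⟩} ∪ D) (D ∪ levelSet k Q' F') :=
        hc.mono le_rfl (hsub.trans Set.subset_union_right)
          (Set.union_subset_union_left _ Set.subset_union_right)
      exact (hD.trans h2).mono (by omega) le_rfl Set.subset_union_right
    · rcases eq_or_ne k' k with rfl | hne
      · exact ⟨Q', F', hQF', Set.subset_union_right⟩
      · obtain ⟨Q, F, h, hs⟩ := hlev k' hk' (by omega)
        exact ⟨Q, F, h, hs.trans Set.subset_union_left⟩

/-- The operator and the load vector of all levels. -/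
theorem exists_levelData (hL : 1 ≤ L) (κ f : X → Image N (L - 1)) :
    ∃ D : Set (ImageFamily N X),
      Computes L σ V init (748 * L) {⟨L - 1, κ⟩, ⟨L - 1, f⟩} D ∧
      ∀ k < L, ∃ Q F, IsLevelData (fun x => feFun N (L - 1) (κ x))
        (fun x => feFun N (L - 1) (f x)) k Q F ∧ levelSet k Q F ⊆ D := by
  obtain ⟨D, hD, h⟩ := exists_levelData_of_le (σ := σ) (V := V) (init := init) hL κ f (L - 1)
    (by omega)
  exact ⟨D, by rwa [Nat.sub_add_cancel hL] at hD, fun k hk => h k hk (by omega)⟩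

/-! ### The steps of the algorithm -/

/-- The images of vectors on the selected nodes. -/
def selectedFamily (V : Selection N) (k : ℕ) (u : X → VVec V k) : ImageFamily N X :=
  ⟨k, fun x => toImage (V k) (u x)⟩

/-- The images of vectors on the closure of the selected nodes. -/
def closureFamily (V : Selection N) (k : ℕ) (v : X → CVec V k) : ImageFamily N X :=
  ⟨k, fun x => toImage (closureNodes V k) (v x)⟩

theorem Computes.congr {A : Set (ImageFamily N X)} {c c' k : ℕ} {g g' : X → Image N k}
    (h : Computes L σ V init c A {⟨k, g⟩}) (hc : c = c') (hg : ∀ x, g' x = g x) :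
    Computes L σ V init c' A {⟨k, g'⟩} := by
  rwa [← hc, funext hg]

/-- A stencil formula has to be right only at the selected nodes; the mask removes whatever the
convolution produces elsewhere. -/
theorem toImage_eq_applyMask_selected {k : ℕ} (u : VVec V k) {g : Image N k}
    (h : ∀ i ∈ V k, toImage (V k) u i = g i) : toImage (V k) u = applyMask V .selected g := by
  funext i
  by_cases hi : i ∈ V k
  · rw [h i hi]
    exact (if_pos hi).symm
  · rw [toImage_of_notMem u hi]
    exact (if_neg hi).symm

theorem toImage_eq_applyMask_closure {k : ℕ} (v : CVec V k) {g : Image N k}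
    (h : ∀ i ∈ closureNodes V k, toImage (closureNodes V k) v i = g i) :
    toImage (closureNodes V k) v = applyMask V .closure g := by
  funext i
  by_cases hi : i ∈ closureNodes V k
  · rw [h i hi]
    exact (if_pos hi).symm
  · rw [toImage_of_notMem v hi]
    exact (if_neg hi).symm

variable {A : Set (ImageFamily N X)}

theorem computes_prolongation (hN : 1 ≤ N) {k : ℕ} (hk : k + 1 < L) {v : X → CVec V k}
    (hv : closureFamily V k v ∈ A) :
    Computes L σ V init 10 A {closureFamily V (k + 1) fun x => prolongation V k *ᵥ v x} := by
  have h := computes_convUp (σ := σ) (V := V) (init := init) hk (s := ({0} : Finset ℕ))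
    (K := fun _ => prolongWeight) (fun _ _ p hp => prolongWeight_eq_zero hp)
    (g := fun _ x => toImage (closureNodes V k) (v x)) (fun _ _ => hv) .closure
  exact h.congr rfl fun x => toImage_eq_applyMask_closure _ fun i hi => by
    rw [toImage_prolongation V hN k _ hi, Finset.sum_singleton]

theorem computes_prolongation_transpose (hN : 1 ≤ N) {k : ℕ} (hk : k < L)
    {v : X → CVec V (k + 1)} (hv : closureFamily V (k + 1) v ∈ A) :
    Computes L σ V init 10 A {closureFamily V k fun x => (prolongation V k)ᵀ *ᵥ v x} := by
  have h := computes_convDown (σ := σ) (V := V) (init := init) hk (s := ({0} : Finset ℕ))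
    (K := fun _ => prolongWeight) (fun _ _ p hp => prolongWeight_eq_zero hp)
    (g := fun _ x => toImage (closureNodes V (k + 1)) (v x)) (fun _ _ => hv) .closure
  exact h.congr rfl fun x => toImage_eq_applyMask_closure _ fun i hi => by
    rw [toImage_prolongation_transpose V hN k _ hi, Finset.sum_singleton]

theorem computes_add {k : ℕ} (hk : k < L) {g h : X → Image N k} (hg : ⟨k, g⟩ ∈ A)
    (hh : ⟨k, h⟩ ∈ A) : Computes L σ V init 19 A {⟨k, fun x => g x + h x⟩} := by
  have := computes_combination (σ := σ) (V := V) (init := init) (A := A) hk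
    (s := (Finset.univ : Finset (Fin 2))) (fun _ => 1) (g := ![g, h])
    (fun a _ => by fin_cases a <;> assumption) .none
  exact this.congr rfl fun x => by
    funext i
    simp [applyMask_none]

theorem computes_add_extend {k : ℕ} (hk : k < L) {u : X → VVec V k} {v : X → CVec V k}
    (hu : selectedFamily V k u ∈ A) (hv : closureFamily V k v ∈ A) :
    Computes L σ V init 19 A {closureFamily V k fun x => v x + extend V k (u x)} := by
  have := computes_add (σ := σ) (V := V) (init := init) hk hv hu
  simpa only [closureFamily, toImage_add, toImage_extend] using this

variable {κ f : X → ℝ × ℝ → ℝ} {k : ℕ} {Q : ℤ × ℤ → X → Image N k} {F : X → Image N k}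

/-- Each direction needs a shift (10) and a product (113), and the masked sum needs 82: `9 * 123 +
82 = 1189`. Entries are trusted only at selected nodes, which are interior. -/
theorem computes_levelMatrix (hσ : IsAdmissibleActivation σ) (hV : ∀ i ∈ V k, IsInterior i)
    (hQF : IsLevelData κ f k Q F) (hA : levelSet k Q F ⊆ A) (hk : k < L) {v : X → CVec V k}
    (hv : closureFamily V k v ∈ A) :
    Computes L σ V init 1189 A {selectedFamily V k fun x => levelMatrix V (κ x) k *ᵥ v x} := by
  have hprod : ∀ d ∈ window, Computes L σ V init 123 A
      {⟨k, fun x i => Q d x i * conv (shiftKernel d) (toImage (closureNodes V k) (v x)) i⟩} := by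
    intro d hd
    have h1 := computes_conv (σ := σ) (V := V) (init := init) hk (s := ({0} : Finset ℕ))
      (K := fun _ => shiftKernel d) (fun _ _ p hp => shiftKernel_eq_zero hd hp)
      (g := fun _ x => toImage (closureNodes V k) (v x)) (fun _ _ => hv) .none
    simp only [applyMask_none, Finset.sum_singleton] at h1
    exact h1.trans (computes_mul hσ hk (Or.inl (hA (Or.inl ⟨d, hd, rfl⟩))) (Or.inr rfl))
  have h := (Computes.biUnion window hprod).trans (computes_combination hk (s := window)
    (fun _ => 1) (fun d hd => Or.inr ⟨d, hd, rfl⟩) .selected)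
  refine h.congr rfl fun x => ?_
  refine toImage_eq_applyMask_selected _ fun i hi => ?_
  rw [toImage_levelMatrix V _ k _ hi]
  exact Finset.sum_congr rfl fun d hd => by rw [one_mul, hQF.op d hd x i (hV i hi)]

/-- Here the nine shifts are part of the final masked convolution: `9 * 113 + 82 = 1099`. -/
theorem computes_levelMatrix_transpose (hσ : IsAdmissibleActivation σ)
    (hV : ∀ i ∈ V k, IsInterior i) (hQF : IsLevelData κ f k Q F) (hA : levelSet k Q F ⊆ A)
    (hk : k < L) {u : X → VVec V k} (hu : selectedFamily V k u ∈ A) :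
    Computes L σ V init 1099 A
      {closureFamily V k fun x => (levelMatrix V (κ x) k)ᵀ *ᵥ u x} := by
  have hprod : ∀ d ∈ window, Computes L σ V init 113 A
      {⟨k, fun x i => Q d x i * toImage (V k) (u x) i⟩} := fun d hd =>
    computes_mul hσ hk (hA (Or.inl ⟨d, hd, rfl⟩)) hu
  have h := (Computes.biUnion window hprod).trans (computes_conv hk (s := window)
    (K := fun d => shiftKernel (-d))
    (fun d hd p hp => shiftKernel_eq_zero (neg_mem_window.2 hd) hp)
    (fun d hd => Or.inr ⟨d, hd, rfl⟩) .closure)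
  refine h.congr rfl fun x => ?_
  refine toImage_eq_applyMask_closure _ fun i hi => ?_
  rw [toImage_levelMatrix_transpose V _ k _ hi]
  refine Finset.sum_congr rfl fun d hd => ?_
  congr 1
  funext j
  -- Off the selected nodes the entry image may be wrong, but the factor `u` is zero there.
  by_cases hj : j ∈ V k
  · rw [hQF.op d hd x j (hV j hj)]
  · rw [toImage_of_notMem _ hj, mul_zero, mul_zero]

/-- The damped correction is a combination of four images: iterate, load, operator applied to `ũ +
u`, and `ū`. The cost is `19 + 1189 + 37`. -/
theorem computes_smooth (hσ : IsAdmissibleActivation σ) (hV : ∀ i ∈ V k, IsInterior i)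
    (hQF : IsLevelData κ f k Q F) (hA : levelSet k Q F ⊆ A) (hk : k < L) (ω : ℕ → ℝ)
    {S : X → State V} (hu : selectedFamily V k (fun x => (S x).u k) ∈ A)
    (hbar : closureFamily V k (fun x => (S x).ubar k) ∈ A)
    (htil : closureFamily V k (fun x => (S x).util k) ∈ A) :
    Computes L σ V init 1245 A {selectedFamily V k fun x =>
      (smooth V (κ x) ω (load V (f x)) (S x) k).u k} := by
  have h1 := computes_add_extend (σ := σ) (init := init) hk hu htil
  have h2 := computes_levelMatrix (κ := κ) (init := init) hσ hV hQF
    (hA.trans (Set.subset_union_left (t := {closureFamily V k fun x =>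
      (S x).util k + extend V k ((S x).u k)}))) hk (Or.inr rfl)
  refine (h1.trans (h2.trans (computes_combination hk (s := (Finset.univ : Finset (Fin 4)))
    ![1, ω k, -ω k, -ω k]
    (g := ![fun x => toImage (V k) ((S x).u k), F,
      fun x => toImage (V k) (levelMatrix V (κ x) k *ᵥ ((S x).util k + extend V k ((S x).u k))),
      fun x => toImage (closureNodes V k) ((S x).ubar k)]) (fun a _ => ?_) .selected))).congr rfl
    fun x => toImage_eq_applyMask_selected _ fun i hi => ?_
  · fin_cases a
    · exact Or.inl (Or.inl hu)
    · exact Or.inl (Or.inl (hA (Or.inr rfl)))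
    · exact Or.inr rfl
    · exact Or.inl (Or.inl hbar)
  · have hF : F x i = load V (f x) k ⟨i, hi⟩ := by
      rw [hQF.load x i (hV i hi), load, loadCoeff, hat_eq_latticeHat]
    simp only [Fin.sum_univ_four, Matrix.cons_val, hF, toImage_of_mem _ hi,
      toImage_of_mem _ (subset_closureNodes V k hi), smooth, Function.update_self]
    simp only [Pi.add_apply, Pi.smul_apply, Pi.sub_apply, smul_eq_mul, restrict,
      add_comm (extend V k _)]
    ring

end Data

/-! ### Simulation of the algorithm -/

/-- The images of the iterates on all levels. -/
def iterateSet {N : ℕ} {X : Type*} (V : Selection N) (L : ℕ) (u : X → (k : ℕ) → VVec V k) :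
    Set (ImageFamily N X) :=
  {p | ∃ k < L, p = selectedFamily V k fun x => u x k}

/-- The images of all variables of the algorithm. -/
def stateSet {N : ℕ} {X : Type*} (V : Selection N) (L : ℕ) (S : X → State V) :
    Set (ImageFamily N X) :=
  {p | ∃ k < L, p = selectedFamily V k (fun x => (S x).u k) ∨
    p = closureFamily V k (fun x => (S x).ubar k) ∨ p = closureFamily V k fun x => (S x).util k}

section Simulation

variable {L N : ℕ} {X : Type*} {σ : ℝ → ℝ} {V : Selection N} {init : X → Features N}
  {κ f : X → ℝ × ℝ → ℝ} {A D : Set (ImageFamily N X)}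

/-- A unit without sources has only its bias, which is zero: one weight. -/
theorem computes_zero {k : ℕ} (hk : k < L) :
    Computes L σ V init 1 A {closureFamily V k fun _ => 0} := by
  have h := computes_combination (σ := σ) (V := V) (init := init) (A := A) hk
    (s := (∅ : Finset ℕ)) (fun _ => 0) (g := fun _ _ => 0) (by simp) .none
  exact h.congr rfl fun x => by
    rw [applyMask_none, toImage_zero]
    rfl

/-- The recursion for the contribution of the coarser levels. -/
theorem computes_interpolation (hN : 1 ≤ N) {k : ℕ} (hk : k + 1 < L) {u : X → VVec V k}
    {v : X → CVec V k} (hu : selectedFamily V k u ∈ A) (hv : closureFamily V k v ∈ A) :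
    Computes L σ V init 29 A
      {closureFamily V (k + 1) fun x => prolongation V k *ᵥ (v x + extend V k (u x))} :=
  (computes_add_extend (by omega) hu hv).trans (computes_prolongation hN hk (Or.inr rfl))

/-- The operator and the load vector of all levels are available. -/
def HasLevelData (L : ℕ) (κ f : X → ℝ × ℝ → ℝ) (A : Set (ImageFamily N X)) : Prop :=
  ∀ k < L, ∃ Q F, IsLevelData κ f k Q F ∧ levelSet k Q F ⊆ A

theorem HasLevelData.mono (h : HasLevelData L κ f D) (hDA : D ⊆ A) : HasLevelData L κ f A :=
  fun k hk => by
    obtain ⟨Q, F, hQF, hs⟩ := h k hk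
    exact ⟨Q, F, hQF, hs.trans hDA⟩

/-- The recursion for the contribution of the finer levels. -/
theorem computes_restriction (hσ : IsAdmissibleActivation σ) (hN : 1 ≤ N)
    (hV : ∀ k < L, ∀ i ∈ V k, IsInterior i) (hA : HasLevelData L κ f A) {k : ℕ} (hk : k + 1 < L)
    {u : X → VVec V (k + 1)} {v : X → CVec V (k + 1)} (hu : selectedFamily V (k + 1) u ∈ A)
    (hv : closureFamily V (k + 1) v ∈ A) :
    Computes L σ V init 1128 A {closureFamily V k fun x =>
      (prolongation V k)ᵀ *ᵥ (v x + (levelMatrix V (κ x) (k + 1))ᵀ *ᵥ u x)} := by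
  obtain ⟨Q, F, hQF, hs⟩ := hA _ hk
  have h1 := computes_levelMatrix_transpose (init := init) hσ (hV _ hk) hQF hs hk hu
  have h2 := computes_add (σ := σ) (V := V) (init := init)
    (A := A ∪ {closureFamily V (k + 1) fun x => (levelMatrix V (κ x) (k + 1))ᵀ *ᵥ u x})
    hk (Or.inl hv) (Or.inr rfl)
  simp only [← toImage_add] at h2
  exact h1.trans (h2.trans (computes_prolongation_transpose hN (by omega) (Or.inr rfl)))

/-- Smoothing changes one variable on one level; the images of all other variables are already
available and cost nothing. -/
theorem computes_smooth_state (hσ : IsAdmissibleActivation σ)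
    (hV : ∀ k < L, ∀ i ∈ V k, IsInterior i) (ω : ℕ → ℝ) {S : X → State V}
    (hA : HasLevelData L κ f A) (hS : stateSet V L S ⊆ A) {k : ℕ} (hk : k < L) :
    Computes L σ V init 1245 A
      (stateSet V L fun x => smooth V (κ x) ω (load V (f x)) (S x) k) := by
  obtain ⟨Q, F, hQF, hs⟩ := hA k hk
  refine (computes_smooth (init := init) hσ (hV k hk) hQF hs hk ω (S := S)
    (hS ⟨k, hk, Or.inl rfl⟩) (hS ⟨k, hk, Or.inr (Or.inl rfl)⟩)
    (hS ⟨k, hk, Or.inr (Or.inr rfl)⟩)).mono le_rfl le_rfl ?_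
  rintro p ⟨k', hk', rfl | rfl | rfl⟩
  · rcases eq_or_ne k' k with rfl | hne
    · exact Or.inr rfl
    · refine Or.inl (hS ⟨k', hk', Or.inl ?_⟩)
      simp only [smooth, Function.update_of_ne hne]
  · exact Or.inl (hS ⟨k', hk', Or.inr (Or.inl rfl)⟩)
  · exact Or.inl (hS ⟨k', hk', Or.inr (Or.inr rfl)⟩)

theorem computes_downStep (hσ : IsAdmissibleActivation σ) (hN : 1 ≤ N)
    (hV : ∀ k < L, ∀ i ∈ V k, IsInterior i) (ω : ℕ → ℝ) {S : X → State V}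
    (hA : HasLevelData L κ f A) (hS : stateSet V L S ⊆ A) {k : ℕ} (hk : k < L) :
    Computes L σ V init 2373 A
      (stateSet V L fun x => downStep V (κ x) ω (load V (f x)) (S x) k) := by
  have h1 := computes_smooth_state (init := init) hσ hV ω hA hS hk
  cases k with
  | zero => exact h1.mono (by norm_num) le_rfl Set.subset_union_right
  | succ j =>
    refine (h1.trans_union (computes_restriction hσ hN hV (hA.mono Set.subset_union_left)
      hk (Or.inr ⟨j + 1, hk, Or.inl rfl⟩) (Or.inr ⟨j + 1, hk, Or.inr (Or.inl rfl)⟩))).mono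
      le_rfl le_rfl ?_
    rintro p ⟨k', hk', rfl | rfl | rfl⟩
    · exact Or.inr (Or.inl ⟨k', hk', Or.inl rfl⟩)
    · rcases eq_or_ne k' j with rfl | hne
      · refine Or.inr (Or.inr ?_)
        simp only [downStep, Function.update_self]
        rfl
      · refine Or.inr (Or.inl ⟨k', hk', Or.inr (Or.inl ?_)⟩)
        simp only [downStep, Function.update_of_ne hne]
    · exact Or.inr (Or.inl ⟨k', hk', Or.inr (Or.inr rfl)⟩)

theorem computes_upStep (hσ : IsAdmissibleActivation σ) (hN : 1 ≤ N)
    (hV : ∀ k < L, ∀ i ∈ V k, IsInterior i) (ω : ℕ → ℝ) {S : X → State V}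
    (hA : HasLevelData L κ f A) (hS : stateSet V L S ⊆ A) {k : ℕ} (hk : k < L) :
    Computes L σ V init 1274 A
      (stateSet V L fun x => upStep V L (κ x) ω (load V (f x)) (S x) k) := by
  have h1 := computes_smooth_state (init := init) hσ hV ω hA hS hk
  by_cases hkL : k + 1 < L
  · refine (h1.trans_union (computes_interpolation hN hkL
      (Or.inr ⟨k, hk, Or.inl rfl⟩) (Or.inr ⟨k, hk, Or.inr (Or.inr rfl)⟩))).mono le_rfl le_rfl ?_
    simp only [upStep, if_pos hkL]
    rintro p ⟨k', hk', rfl | rfl | rfl⟩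
    · exact Or.inr (Or.inl ⟨k', hk', Or.inl rfl⟩)
    · exact Or.inr (Or.inl ⟨k', hk', Or.inr (Or.inl rfl)⟩)
    · rcases eq_or_ne k' (k + 1) with rfl | hne
      · refine Or.inr (Or.inr ?_)
        simp only [Function.update_self]
        rfl
      · refine Or.inr (Or.inl ⟨k', hk', Or.inr (Or.inr ?_)⟩)
        simp only [Function.update_of_ne hne]
  · simp only [upStep, if_neg hkL]
    exact h1.mono (by norm_num) le_rfl Set.subset_union_right

/-- A loop costs its length times one step, since the level data stay available and each state is
computed from the previous one. -/
theorem computes_foldl {step : X → State V → ℕ → State V} {c : ℕ}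
    (hstep : ∀ (A : Set (ImageFamily N X)) (S : X → State V), HasLevelData L κ f A →
      stateSet V L S ⊆ A → ∀ k < L,
        Computes L σ V init c A (stateSet V L fun x => step x (S x) k))
    (l : List ℕ) (hl : ∀ k ∈ l, k < L) {S : X → State V} (hA : HasLevelData L κ f A)
    (hS : stateSet V L S ⊆ A) :
    Computes L σ V init (c * l.length) A (stateSet V L fun x => l.foldl (step x) (S x)) := by
  induction l generalizing S A with
  | nil => exact Computes.of_subset hS
  | cons k l ih =>
    have h1 := hstep A S hA hS k (hl k List.mem_cons_self)
    have h2 := ih (fun k' hk' => hl k' (List.mem_cons_of_mem k hk'))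
      (hA.mono (Set.subset_union_left (t := stateSet V L fun x => step x (S x) k)))
      Set.subset_union_right
    refine (h1.trans h2).mono ?_ le_rfl Set.subset_union_right
    rw [List.length_cons]
    linarith

theorem computes_auxTilde (hN : 1 ≤ N) {u : X → (k : ℕ) → VVec V k}
    (hu : iterateSet V L u ⊆ A) (n : ℕ) (hn : n < L) :
    Computes L σ V init (29 * (n + 1)) A
      {p | ∃ k ≤ n, p = closureFamily V k fun x => auxTilde V (u x) k} := by
  induction n with
  | zero =>
    refine (computes_zero (k := 0) hn).mono (by norm_num) le_rfl ?_
    rintro p ⟨k, hk, rfl⟩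
    obtain rfl := Nat.le_zero.1 hk
    exact Or.inr rfl
  | succ n ih =>
    refine ((ih (by omega)).trans_union (computes_interpolation hN hn
      (Or.inl (hu ⟨n, by omega, rfl⟩)) (Or.inr ⟨n, le_rfl, rfl⟩))).mono
      (by omega) le_rfl ?_
    rintro p ⟨k, hk, rfl⟩
    rcases Nat.le_succ_iff.1 hk with hk | rfl
    · exact Or.inr (Or.inl ⟨k, hk, rfl⟩)
    · exact Or.inr (Or.inr rfl)

/-- The recursion starts at the finest level `L - 1`; `d` is the distance to it, whence `k + d + 1 =
L`. -/
theorem computes_auxBar (hσ : IsAdmissibleActivation σ) (hN : 1 ≤ N)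
    (hV : ∀ k < L, ∀ i ∈ V k, IsInterior i) (hA : HasLevelData L κ f A)
    {u : X → (k : ℕ) → VVec V k} (hu : iterateSet V L u ⊆ A) (n : ℕ) (hn : n < L) :
    Computes L σ V init (1128 * (n + 1)) A
      {p | ∃ d k, d ≤ n ∧ k + d + 1 = L ∧
        p = closureFamily V k fun x => auxBar V (κ x) (u x) d k} := by
  induction n with
  | zero =>
    refine (computes_zero (k := L - 1) (by omega)).mono (by norm_num) le_rfl ?_
    rintro p ⟨d, k, hd, hk, rfl⟩
    obtain rfl := Nat.le_zero.1 hd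
    obtain rfl : k = L - 1 := by omega
    exact Or.inr rfl
  | succ n ih =>
    obtain ⟨k, hk⟩ : ∃ k, k + (n + 1) + 1 = L := ⟨L - (n + 2), by omega⟩
    refine ((ih (by omega)).trans_union (computes_restriction (k := k) hσ hN hV
      (hA.mono Set.subset_union_left) (by omega) (Or.inl (hu ⟨k + 1, by omega, rfl⟩))
      (Or.inr ⟨n, k + 1, le_rfl, by omega, rfl⟩))).mono (by omega) le_rfl ?_
    rintro p ⟨d, k', hd, hk', rfl⟩
    rcases Nat.le_succ_iff.1 hd with hd | rfl
    · exact Or.inr (Or.inl ⟨d, k', hd, hk', rfl⟩)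
    · obtain rfl : k' = k := by omega
      exact Or.inr (Or.inr rfl)

/-- One sweep of the algorithm. -/
theorem computes_llmg (hσ : IsAdmissibleActivation σ) (hN : 1 ≤ N) (hL : 1 ≤ L)
    (hV : ∀ k < L, ∀ i ∈ V k, IsInterior i) (ω : ℕ → ℝ) (hA : HasLevelData L κ f A)
    {u : X → (k : ℕ) → VVec V k} (hu : iterateSet V L u ⊆ A) :
    Computes L σ V init (4804 * L) A
      (iterateSet V L fun x => llmg V L (κ x) ω (load V (f x)) (u x)) := by
  let S₀ : X → State V := fun x =>
    { u := u x, ubar := fun k => auxBar V (κ x) (u x) (L - 1 - k) k, util := auxTilde V (u x) }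
  -- Initialization costs `29 + 1128` per level; the downward and upward loops add 2373 and 1274, in
  -- total 4804.
  have h₀ : Computes L σ V init (1157 * L) A (stateSet V L S₀) := by
    refine ((computes_auxTilde hN hu (L - 1) (by omega)).union
      (computes_auxBar hσ hN hV hA hu (L - 1) (by omega))).mono (by omega) le_rfl ?_
    rintro p ⟨k, hk, rfl | rfl | rfl⟩
    · exact Or.inl (hu ⟨k, hk, rfl⟩)
    · exact Or.inr (Or.inr ⟨L - 1 - k, k, by omega, by omega, rfl⟩)
    · exact Or.inr (Or.inl ⟨k, by omega, rfl⟩)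
  have h₁ := computes_foldl (init := init)
    (fun A S hA hS k hk => computes_downStep hσ hN hV ω hA hS hk)
    (List.range L).reverse (fun k hk => by simpa using hk)
    (hA.mono (Set.subset_union_left (t := stateSet V L S₀))) Set.subset_union_right
  have h₂ := computes_foldl (init := init)
    (fun A S hA hS k hk => computes_upStep hσ hN hV ω hA hS hk)
    (List.range L) (fun k hk => by simpa using hk)
    ((hA.mono (Set.subset_union_left (t := stateSet V L S₀))).mono
      (Set.subset_union_left (t := stateSet V L fun x => (List.range L).reverse.foldl
        (downStep V (κ x) ω (load V (f x))) (S₀ x)))) Set.subset_union_right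
  rw [List.length_reverse, List.length_range] at h₁
  rw [List.length_range] at h₂
  refine (h₀.trans (h₁.trans h₂)).mono (by omega) le_rfl ?_
  rintro p ⟨k, hk, rfl⟩
  exact Or.inr ⟨k, hk, Or.inl rfl⟩

theorem computes_iterate (hσ : IsAdmissibleActivation σ) (hN : 1 ≤ N) (hL : 1 ≤ L)
    (hV : ∀ k < L, ∀ i ∈ V k, IsInterior i) (ω : ℕ → ℝ) (hA : HasLevelData L κ f A)
    (h0 : iterateSet V L (fun _ : X => 0) ⊆ A) (m : ℕ) :
    Computes L σ V init (4804 * L * m) A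
      (iterateSet V L fun x => (llmg V L (κ x) ω (load V (f x)))^[m] 0) := by
  induction m with
  | zero => exact Computes.of_subset h0
  | succ m ih =>
    have h := computes_llmg (init := init) hσ hN hL hV ω
      (hA.mono (Set.subset_union_left (t := iterateSet V L fun x =>
        (llmg V L (κ x) ω (load V (f x)))^[m] 0))) Set.subset_union_right
    simp only [Function.iterate_succ_apply']
    exact (ih.trans h).mono (by linarith) le_rfl Set.subset_union_right

end Simulation

/-! ### The approximation theorem -/

/-- The eigenvalues of `C • 1 - A` are `C - μ` with `μ` in the spectrum of `A`. -/
theorem posSemidef_smul_one_sub {n : Type*} [Fintype n] [DecidableEq n] {A : Matrix n n ℝ}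
    (hA : A.IsHermitian) {c C : ℝ} (h : spectrum ℝ A ⊆ Set.Icc c C) :
    (C • (1 : Matrix n n ℝ) - A).PosSemidef := by
  have hH : (C • (1 : Matrix n n ℝ) - A).IsHermitian := by
    refine IsHermitian.sub ?_ hA
    rw [IsHermitian, conjTranspose_smul, conjTranspose_one, star_trivial]
  rw [hH.posSemidef_iff_eigenvalues_nonneg]
  intro i
  have hmem := hH.eigenvalues_mem_spectrum_real i
  generalize hH.eigenvalues i = μ at hmem
  have : C - μ ∈ spectrum ℝ A := by
    rw [spectrum.mem_iff] at hmem ⊢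
    rw [← IsUnit.neg_iff]
    convert hmem using 2
    rw [Algebra.algebraMap_eq_smul_one, Algebra.algebraMap_eq_smul_one, sub_smul]
    abel
  exact sub_nonneg.1 (by simpa using (h this).2)

theorem energyNorm_le {n : Type*} [Fintype n] [DecidableEq n] {A : Matrix n n ℝ}
    (hA : A.IsHermitian) {c C : ℝ} (h : spectrum ℝ A ⊆ Set.Icc c C) (hC : 0 ≤ C) {v : n → ℝ}
    {η : ℝ} (hv : ∀ i, |v i| ≤ η) : energyNorm A v ≤ Real.sqrt (C * (Fintype.card n * η ^ 2)) := by
  refine Real.sqrt_le_sqrt ?_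
  have h1 := (posSemidef_smul_one_sub hA h).dotProduct_mulVec_nonneg v
  rw [star_trivial, sub_mulVec, smul_mulVec, one_mulVec, dotProduct_sub, dotProduct_smul,
    sub_nonneg, smul_eq_mul] at h1
  refine h1.trans (mul_le_mul_of_nonneg_left ?_ hC)
  calc v ⬝ᵥ v ≤ ∑ _i : n, η ^ 2 := Finset.sum_le_sum fun i _ => by
        rw [← sq]
        exact sq_le_sq' (neg_le_of_abs_le (hv i)) (le_of_abs_le (hv i))
    _ = Fintype.card n * η ^ 2 := by simp

theorem stiffness_isHermitian {N : ℕ} (V : Selection N) (L : ℕ) (κ : ℝ × ℝ → ℝ) :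
    (stiffness V L κ).IsHermitian := by
  ext p q
  rw [conjTranspose_apply, star_trivial, stiffness, stiffness, darcyForm_comm]

/-- The empty network already holds `κ` and `f` in channels `0` and `1`, and the zero starting
iterate in the unwritten channel `2` of every level. -/
theorem realizable_inputs {L N : ℕ} {X : Type*} (σ : ℝ → ℝ) (V : Selection N)
    {κ f : X → Image N (L - 1)} {M : ℝ} (hκ : ∀ x i, |κ x i| ≤ M) (hf : ∀ x i, |f x i| ≤ M) :
    Realizable L σ V (fun x => inputFeatures L (κ x) (f x)) 0
      ({⟨L - 1, κ⟩, ⟨L - 1, f⟩} ∪ iterateSet V L fun _ : X => 0) := by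
  have hin : ∀ x, inputFeatures L (κ x) (f x) (L - 1) =
      Function.update (Function.update (0 : ℕ → Image N (L - 1)) 0 (κ x)) 1 (f x) := fun x => Function.update_self _ _ _
  have hzero : ∀ x k, inputFeatures L (κ x) (f x) k 2 = fun _ => 0 := fun x k => by
    rw [inputFeatures]
    rcases eq_or_ne k (L - 1) with rfl | h
    · rw [Function.update_self, Function.update_of_ne (by norm_num),
        Function.update_of_ne (by norm_num)]
      rfl
    · rw [Function.update_of_ne h]
      rfl
  refine ⟨fun _ => [], fun _ => by simp, 3, ?_⟩
  rintro p ((rfl | rfl) | ⟨k, hk, rfl⟩)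
  · refine ⟨0, by norm_num, fun i => ?_⟩
    simpa [run, hin] using approximates_of_bounded fun x => hκ x i
  · refine ⟨1, by norm_num, fun i => ?_⟩
    simpa [run, hin] using approximates_of_bounded fun x => hf x i
  · refine ⟨2, by norm_num, fun i => ?_⟩
    simp only [run, List.foldl_nil, hzero, selectedFamily, Pi.zero_apply, toImage_zero]
    exact approximates_of_bounded (X := X) (g := fun _ => 0) (B := 0) (by simp)

/-- Iterates of the algorithm are realizable, and no weights are needed if there are no sweeps. -/
theorem realizable_iterate {L N : ℕ} {X : Type*} {σ : ℝ → ℝ} (hσ : IsAdmissibleActivation σ)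
    (hN : 1 ≤ N) (hL : 1 ≤ L) {V : Selection N} (hV : ∀ k < L, ∀ i ∈ V k, IsInterior i)
    (ω : ℕ → ℝ) (m : ℕ) {κ f : X → Image N (L - 1)} {M : ℝ} (hκ : ∀ x i, |κ x i| ≤ M)
    (hf : ∀ x i, |f x i| ≤ M) :
    Realizable L σ V (fun x => inputFeatures L (κ x) (f x)) (5552 * L * m)
      (iterateSet V L fun x => (llmg V L (feFun N (L - 1) (κ x)) ω
        (load V (feFun N (L - 1) (f x))))^[m] 0) := by
  have h0 := realizable_inputs (L := L) σ V hκ hf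
  -- For `m = 0` the bound leaves no weights, not even for the level data; the zero iterate needs
  -- none. For `m ≥ 1` the one-time cost `748 * L` is at most `748 * L * m`, and `748 + 4804 =
  -- 5552`.
  rcases m.eq_zero_or_pos with rfl | hm
  · exact h0.mono (by simp) Set.subset_union_right
  · obtain ⟨D, hD, hdata⟩ := exists_levelData (σ := σ) (V := V)
      (init := fun x => inputFeatures L (κ x) (f x)) hL κ f
    have h1 := hD _ _ Set.subset_union_left h0
    have h2 := computes_iterate (init := fun x => inputFeatures L (κ x) (f x)) hσ hN hL hV ω
      ((show HasLevelData L _ _ D from hdata).mono Set.subset_union_right)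
      (Set.subset_union_right.trans Set.subset_union_left) m _ _ le_rfl h1
    refine h2.mono ?_ Set.subset_union_right
    nlinarith [Nat.mul_le_mul_left L hm]

theorem exists_cnn_approximating_llmg {σ : ℝ → ℝ} (hσ : IsAdmissibleActivation σ) {N L : ℕ} (m : ℕ)
    (hN : 1 ≤ N) (hL : 1 ≤ L) {V : Selection N} (hV : ∀ k < L, ∀ i ∈ V k, IsInterior i)
    {c₀ C₀ : ℝ} (hC₀ : 0 < C₀) (ω : ℕ → ℝ) {Γ : Type*} {κ : Γ → Image N (L - 1)}
    (hspec : ∀ y, spectrum ℝ (stiffness V L (feFun N (L - 1) (κ y))) ⊆ Set.Icc c₀ C₀)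
    {ε : ℝ} (hε : 0 < ε) (M : ℝ) :
    ∃ Ψ : CNN L,
      (∀ (y : Γ) (f : Image N (L - 1)), (∀ i, |κ y i| ≤ M) → (∀ i, |f i| ≤ M) →
        energyNorm (stiffness V L (feFun N (L - 1) (κ y)))
          (Ψ.realize σ V (κ y) f -
            llmgIterate V L (feFun N (L - 1) (κ y)) (feFun N (L - 1) f) ω m) ≤ ε) ∧
      (Ψ.numWeights : ℝ) ≤ 5552 * L * m := by
  classical
  -- Inputs are the admissible pairs `(y, f)`. Convergence uniform on this set provides one network
  -- for all of them.
  let X : Type _ := {x : Γ × Image N (L - 1) //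
    (∀ i, |κ x.1 i| ≤ M) ∧ ∀ i, |x.2 i| ≤ M}
  obtain ⟨us, hus, b, hb⟩ := realizable_iterate (X := X) hσ hN hL hV ω m
    (κ := fun x => κ x.1.1) (f := fun x => x.1.2) (fun x => x.2.1) (fun x => x.2.2)
  choose! c hcb hc using fun (k : Fin L) => hb _ ⟨k, k.2, rfl⟩
  obtain ⟨η, hη, hηε⟩ : ∃ η : ℝ, 0 < η ∧
      C₀ * (Fintype.card (Dof V L) * η ^ 2) ≤ ε ^ 2 := by
    -- The `+ 1` keeps the denominator positive when no nodes are selected.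
    refine ⟨ε / Real.sqrt (C₀ * (Fintype.card (Dof V L) + 1)), by positivity, ?_⟩
    rw [div_pow, Real.sq_sqrt (by positivity), mul_div_assoc', mul_div_assoc', div_le_iff₀
      (by positivity)]
    nlinarith [mul_pos hC₀ (pow_pos hε 2)]
  have hlim : ∀ᶠ q : ℝ × X in paramFilter X, ∀ p : Dof V L,
      |run σ V (us q.1) (inputFeatures L (κ q.2.1.1) q.2.1.2)
        p.1 (c p.1) p.2.1 - llmgIterate V L
          (feFun N (L - 1) (κ q.2.1.1))
          (feFun N (L - 1) q.2.1.2) ω m p| < η := by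
    rw [Filter.eventually_all]
    intro p
    have h := (Asymptotics.isLittleO_one_iff ℝ).1 (hc p.1 p.2.1).2
    filter_upwards [(Metric.tendsto_nhds.1 h) η hη] with q hq
    simpa [selectedFamily, toImage_of_mem _ p.2.2,
      llmgIterate] using hq
  -- Punctured neighbourhoods of zero are nonempty, so some fixed `δ` works; eventually along `⊤`
  -- means for every input.
  obtain ⟨δ, hδ⟩ := hlim.curry.exists
  refine ⟨⟨us δ, c⟩, fun y f hy hf => ?_, ?_⟩
  · have hx := Filter.eventually_top.1 hδ ⟨(y, f), hy, hf⟩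
    refine (energyNorm_le (stiffness_isHermitian V L _) (hspec y)
      hC₀.le fun p => (hx p).le).trans ?_
    exact Real.sqrt_le_iff.2 ⟨hε.le, hηε⟩
  · exact_mod_cast hus δ

end LocalMultigrid

end

theorem mainTheorem5 :
    ∃ C : ℝ, 0 < C ∧
      ∀ (σ : ℝ → ℝ), LocalMultigrid.IsAdmissibleActivation σ →
      ∀ (N L m : ℕ), 1 ≤ N → 1 ≤ L →
      ∀ (V : LocalMultigrid.Selection N),
        (∀ k < L, ∀ i ∈ V k, LocalMultigrid.IsInterior i) →
      ∀ (c₀ C₀ : ℝ), 0 < c₀ → 0 < C₀ →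
      ∀ (ω : ℕ → ℝ), (∀ k < L, 0 < ω k ∧ ω k ≤ C₀⁻¹) →
      ∀ (Γ : Type*) (κ : Γ → LocalMultigrid.Image N (L - 1)),
        (∀ y : Γ, spectrum ℝ
          (LocalMultigrid.stiffness V L (LocalMultigrid.feFun N (L - 1) (κ y))) ⊆ Set.Icc c₀ C₀) →
      ∀ (ε M : ℝ), 0 < ε → 0 < M →
      ∃ Ψ : LocalMultigrid.CNN L,
        (∀ (y : Γ) (f : LocalMultigrid.Image N (L - 1)),
          (∀ i, |κ y i| ≤ M) → (∀ i, |f i| ≤ M) →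
          LocalMultigrid.energyNorm
            (LocalMultigrid.stiffness V L (LocalMultigrid.feFun N (L - 1) (κ y)))
            (Ψ.realize σ V (κ y) f -
              LocalMultigrid.llmgIterate V L (LocalMultigrid.feFun N (L - 1) (κ y))
                (LocalMultigrid.feFun N (L - 1) f) ω m) ≤ ε) ∧
        (Ψ.numWeights : ℝ) ≤ C * L * m := by
  refine ⟨5552, by norm_num, ?_⟩
  intro σ hσ N L m hN hL V hV c₀ C₀ _ hC₀ ω _ Γ κ hspec ε M hε _
  exact LocalMultigrid.exists_cnn_approximating_llmg hσ m hN hL hV hC₀ ω hspec hε M
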